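/- Let $N\ge 1$ be an integer, $s\in(0,1)$, $q\in(1,2)$, and let $\Omega\subset\mathbb R^N$ be an open set. For $v:\mathbb R^N\to\mathbb R$ measurable write $$[v]^2=\int_{\mathbb R^N}\int_{\mathbb R^N}\frac{(v(x)-v(y))^2}{|x-y|^{N+2s}}\,dx\,dy .$$ For an open set $U\subset\mathbb R^N$ let $\mathcal D^{s,2}_0(U)$ be the completion of $C_c^\infty(U)$ with respect to the norm $[\,\cdot\,]$, and let $$\lambda_1(U,s,q)=\inf\Big\{[\varphi]^2:\ \varphi\in C_c^\infty(U),\ \int_U|\varphi|^q\,dx=1\Big\}.$$ If $\lambda_1(U,s,q)>0$ (for example, if $U$ is bounded), then $\mathcal D^{s,2}_0(U)$ is a space of functions that embeds into $L^q(U)$, and the fractional Lane–Emden density $w_{U,s,q}$ of $U$ is the unique minimiser of $$\frac12[\varphi]^2-\frac1q\int_U\varphi^q\,dx$$ among all $\varphi\in\mathcal D^{s,2}_0(U)$ with $\varphi\ge0$ a.e. in $U$. If $\lambda_1(U,s,q)=0$, the density is defined as $w_{U,s,q}(x)=\lim_{r\to\infty}w_{U\cap B_r,s,q}(x)\in[0,\infty]$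 for a.e. $x\in U$, where $B_r$ is the ball of radius $r$ centred at the origin and the limit is taken along integer radii. Then, for every $u\in C_c^\infty(\Omega)$, $$\int_\Omega\frac{u^2}{w_{\Omega,s,q}^{\,2-q}}\,dx\le\int_{\mathbb R^N}\int_{\mathbb R^N}\frac{(u(x)-u(y))^2}{|x-y|^{N+2s}}\,dx\,dy,$$ with the agreement that the integrand on the left is $0$ at all points where $w_{\Omega,s,q}=+\infty$. -/

import Mathlib

open MeasureTheory Filter Topology
open scoped ENNReal ContDiff

noncomputable section

namespace FracLaneEmden

/-- `φ ∈ C_c^∞(Ω)`: smooth, with compact support contained in `Ω`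
(extended by `0` to the whole space). -/
structure IsTestFunction {N : ℕ} (Ω : Set (EuclideanSpace ℝ (Fin N)))
    (φ : EuclideanSpace ℝ (Fin N) → ℝ) : Prop where
  smooth : ContDiff ℝ ∞ φ
  compact : HasCompactSupport φ
  supp : tsupport φ ⊆ Ω

/-- The Gagliardo double integral `∬ (u(x) - u(y))² / |x - y|^(N + 2s) dx dy` over `ℝ^N × ℝ^N`,
with values in `[0, ∞]`. -/
def gagliardo {N : ℕ} (s : ℝ) (u : EuclideanSpace ℝ (Fin N) → ℝ) : ℝ≥0∞ :=
  ∫⁻ x, ∫⁻ y, ENNReal.ofReal ((u x - u y) ^ 2 / ‖x - y‖ ^ ((N : ℝ) + 2 * s))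

/-- `∫_Ω |u|^q dx`, with values in `[0, ∞]`. -/
def powerIntegral {N : ℕ} (q : ℝ) (Ω : Set (EuclideanSpace ℝ (Fin N)))
    (u : EuclideanSpace ℝ (Fin N) → ℝ) : ℝ≥0∞ :=
  ∫⁻ x in Ω, ENNReal.ofReal (|u x| ^ q)

/-- The first `q`-semilinear `s`-eigenvalue `λ₁(Ω, s, q)`: the infimum of the Gagliardo double
integral over all `φ ∈ C_c^∞(Ω)` with `∫_Ω |φ|^q = 1` (it is `∞` if `Ω` is empty). -/
def lambda1 {N : ℕ} (s q : ℝ) (Ω : Set (EuclideanSpace ℝ (Fin N))) : ℝ≥0∞ :=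
  ⨅ (φ : EuclideanSpace ℝ (Fin N) → ℝ) (_ : IsTestFunction Ω φ) (_ : powerIntegral q Ω φ = 1),
    gagliardo s φ

/-- Membership in `𝓓₀^{s,2}(Ω)`, the completion of `C_c^∞(Ω)` with respect to the square root of
the Gagliardo double integral, realised as a space of functions on `ℝ^N`: `u` is the limit, both
in the Gagliardo norm and almost everywhere, of a sequence of test functions.
It is used only when `λ₁(Ω, s, q) > 0` for some `q ∈ (1,2)`. Then Cauchy sequences of test functions
converge in `L^q`, hence almost everywhere along a subsequence, and the a.e. limit determines the
element of the completion, so that this is the completion itself. -/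
def MemD0 {N : ℕ} (s : ℝ) (Ω : Set (EuclideanSpace ℝ (Fin N)))
    (u : EuclideanSpace ℝ (Fin N) → ℝ) : Prop :=
  ∃ φ : ℕ → EuclideanSpace ℝ (Fin N) → ℝ,
    (∀ n, IsTestFunction Ω (φ n)) ∧
    Tendsto (fun n => gagliardo s (u - φ n)) atTop (𝓝 0) ∧
    ∀ᵐ x, Tendsto (fun n => φ n x) atTop (𝓝 (u x))

/-- The free energy `½ ∬ (φ(x) - φ(y))² / |x - y|^(N + 2s) dx dy - (1/q) ∫_Ω |φ|^q dx`.
Both terms are finite for `φ ∈ 𝓓₀^{s,2}(Ω)` when `λ₁(Ω, s, q) > 0`. -/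
def freeEnergy {N : ℕ} (s q : ℝ) (Ω : Set (EuclideanSpace ℝ (Fin N)))
    (φ : EuclideanSpace ℝ (Fin N) → ℝ) : ℝ :=
  1 / 2 * (gagliardo s φ).toReal - 1 / q * (powerIntegral q Ω φ).toReal

/-- `w` minimises the free energy among the elements of `𝓓₀^{s,2}(Ω)` that are non-negative
almost everywhere in `Ω`. -/
structure IsLeastEnergy {N : ℕ} (s q : ℝ) (Ω : Set (EuclideanSpace ℝ (Fin N)))
    (w : EuclideanSpace ℝ (Fin N) → ℝ) : Prop where
  mem : MemD0 s Ω w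
  nonneg : ∀ᵐ x ∂(volume.restrict Ω), 0 ≤ w x
  le : ∀ φ, MemD0 s Ω φ → (∀ᵐ x ∂(volume.restrict Ω), 0 ≤ φ x) →
    freeEnergy s q Ω w ≤ freeEnergy s q Ω φ

open Classical in
/-- (A representative of) the minimiser of the free energy among the non-negative elements of
`𝓓₀^{s,2}(Ω)`. It exists, and is unique up to null sets, when `λ₁(Ω, s, q) > 0`.
The default value `0` is the least favourable one in the Lane–Emden inequality. -/
def leastEnergy {N : ℕ} (s q : ℝ) (Ω : Set (EuclideanSpace ℝ (Fin N))) :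
    EuclideanSpace ℝ (Fin N) → ℝ :=
  if h : ∃ w, IsLeastEnergy s q Ω w then h.choose else 0

open Classical in
/-- The `(s,q)`-Lane–Emden density `w_{Ω,s,q}`, with values in `[0, ∞]`. If `λ₁(Ω, s, q) > 0`, it is
the minimiser of the free energy; otherwise it is the limit of the densities of `Ω ∩ B_r` as
`r → ∞`. These are non-decreasing in `r` up to null sets, so that the limit exists almost everywhere
along the integer radii, where it is the upper limit written below. -/
def laneEmdenDensity {N : ℕ} (s q : ℝ) (Ω : Set (EuclideanSpace ℝ (Fin N)))
    (x : EuclideanSpace ℝ (Fin N)) : ℝ≥0∞ :=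
  if 0 < lambda1 s q Ω then ENNReal.ofReal (leastEnergy s q Ω x)
  else limsup (fun n : ℕ => ENNReal.ofReal (leastEnergy s q (Ω ∩ Metric.ball 0 (n : ℝ)) x)) atTop

end FracLaneEmden

end

noncomputable section

namespace FracLaneEmden

/-! ### The Gagliardo double integral: algebra, Fatou, semicontinuity -/

section GagliardoTools

variable {N : ℕ} {s : ℝ} {Ω : Set (EuclideanSpace ℝ (Fin N))}
  {u v g : EuclideanSpace ℝ (Fin N) → ℝ}

/-! Write F for the free energy and [v]² for the Gagliardo integral. The engine is hidden convexity:
the triangle inequality in ℝ², applied to the pairs (φ, ψ) at two points, gives [√(φ² + ψ²)]² ≤ [φ]²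
+ [ψ]². If w minimises F, comparison with √(w² + t u²) yields (1/q) ∫ ((w² + t u²)^(q/2) - w^q) ≤
(t/2) [u]². The power q/2 is concave, so its tangent at w² + t u² bounds the left side below by
(t/2) ∫ u² / (w² + t u²)^(1 - q/2). Cancel t/2 and let t → 0 with Fatou. Neither an Euler-Lagrange
equation nor positivity of w enters. The competitor is not smooth;
`exists_isTestFunction_nonneg_approx` and `MemD0.add_lintegral_le` justify its use by approximation.

The density is a chosen minimiser with default value 0, so existence has to be proved
(`exists_isLeastEnergy`). Hidden convexity serves again: for almost minimisers φ and ψ, the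
competitor √((φ² + ψ²)/2) and the uniform concavity of the power q/2 force φ^q and ψ^q to be close
in L¹, and then the parallelogram law makes φ and ψ close in the Gagliardo seminorm
(`exists_modulus_of_le_freeEnergy`). A suitable minimising sequence is thus Cauchy, and no
compactness is required.

If λ₁ = 0, the bounded pieces Ω ∩ B_n still have λ₁ > 0 by a Poincaré inequality. The estimate holds
on them as soon as B_n contains the support of u, and Fatou passes to the limit in n, since division
turns the limsup of the densities into a liminf of the integrands. -/

lemma measurable_gagliardo_integrand (s : ℝ) (hu : Measurable u) :
    Measurable (fun p : EuclideanSpace ℝ (Fin N) × EuclideanSpace ℝ (Fin N) =>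
      ENNReal.ofReal ((u p.1 - u p.2) ^ 2 / ‖p.1 - p.2‖ ^ ((N : ℝ) + 2 * s))) := by
  fun_prop

lemma gagliardo_congr_ae (h : u =ᵐ[volume] v) : gagliardo s u = gagliardo s v := by
  unfold gagliardo
  refine lintegral_congr_ae ?_
  filter_upwards [h] with x hx
  refine lintegral_congr_ae ?_
  filter_upwards [h] with y hy
  rw [hx, hy]

/-- A pointwise inequality between squared increments gives one between the double integrals. -/
lemma gagliardo_le_of_forall_sq_le {a b : ℝ} (ha : 0 ≤ a) (hb : 0 ≤ b) (hu : Measurable u)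
    (hv : Measurable v)
    (h : ∀ x y, (g x - g y) ^ 2 ≤ a * (u x - u y) ^ 2 + b * (v x - v y) ^ 2) :
    gagliardo s g ≤ ENNReal.ofReal a * gagliardo s u + ENNReal.ofReal b * gagliardo s v := by
  have mu := measurable_gagliardo_integrand s hu
  have mv := measurable_gagliardo_integrand s hv
  unfold gagliardo
  rw [← lintegral_const_mul _ mu.lintegral_prod_right', ← lintegral_const_mul _ mv.lintegral_prod_right',
    ← lintegral_add_left (mu.lintegral_prod_right'.const_mul _)]
  refine lintegral_mono fun x => ?_
  have mux := mu.comp (measurable_prodMk_left (x := x))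
  have mvx := mv.comp (measurable_prodMk_left (x := x))
  simp only [Function.comp_def] at mux mvx
  rw [← lintegral_const_mul _ mux, ← lintegral_const_mul _ mvx,
    ← lintegral_add_left (mux.const_mul _)]
  refine lintegral_mono fun y => ?_
  rw [← ENNReal.ofReal_mul ha, ← ENNReal.ofReal_mul hb, ← ENNReal.ofReal_add (by positivity)
    (by positivity)]
  refine ENNReal.ofReal_le_ofReal ?_
  rw [← mul_div_assoc, ← mul_div_assoc, ← add_div]
  exact div_le_div_of_nonneg_right (h x y) (by positivity)

lemma gagliardo_const_mul (c : ℝ) (u : EuclideanSpace ℝ (Fin N) → ℝ) :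
    gagliardo s (fun x => c * u x) = ENNReal.ofReal (c ^ 2) * gagliardo s u := by
  unfold gagliardo
  rw [← lintegral_const_mul' _ _ ENNReal.ofReal_ne_top]
  refine lintegral_congr fun x => ?_
  rw [← lintegral_const_mul' _ _ ENNReal.ofReal_ne_top]
  refine lintegral_congr fun y => ?_
  rw [← ENNReal.ofReal_mul (sq_nonneg _)]
  congr 1
  ring

@[simp] lemma gagliardo_zero : gagliardo s (fun _ : EuclideanSpace ℝ (Fin N) => (0 : ℝ)) = 0 := by
  simp [gagliardo]

lemma gagliardo_sub_comm (u v : EuclideanSpace ℝ (Fin N) → ℝ) :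
    gagliardo s (u - v) = gagliardo s (v - u) := by
  unfold gagliardo
  refine lintegral_congr fun x => lintegral_congr fun y => ?_
  congr 2
  simp only [Pi.sub_apply]
  ring

lemma gagliardo_parallelogram (hu : Measurable u) (hv : Measurable v) :
    gagliardo s (fun x => u x + v x) + gagliardo s (fun x => u x - v x) =
      2 * gagliardo s u + 2 * gagliardo s v := by
  have mu := measurable_gagliardo_integrand s hu
  have mv := measurable_gagliardo_integrand s hv
  have ma := measurable_gagliardo_integrand s (hu.add hv)
  have ms := measurable_gagliardo_integrand s (hu.sub hv)
  simp only [Pi.add_apply, Pi.sub_apply] at ma ms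
  unfold gagliardo
  rw [← lintegral_const_mul _ mu.lintegral_prod_right', ← lintegral_const_mul _ mv.lintegral_prod_right',
    ← lintegral_add_left (mu.lintegral_prod_right'.const_mul _),
    ← lintegral_add_left (ma.lintegral_prod_right')]
  refine lintegral_congr fun x => ?_
  have mux := mu.comp (measurable_prodMk_left (x := x))
  have mvx := mv.comp (measurable_prodMk_left (x := x))
  have max := ma.comp (measurable_prodMk_left (x := x))
  simp only [Function.comp_def] at mux mvx max
  rw [← lintegral_const_mul _ mux, ← lintegral_const_mul _ mvx,
    ← lintegral_add_left (mux.const_mul _), ← lintegral_add_left max]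
  refine lintegral_congr fun y => ?_
  have hk : 0 ≤ ‖x - y‖ ^ ((N : ℝ) + 2 * s) := by positivity
  beta_reduce
  generalize ‖x - y‖ ^ ((N : ℝ) + 2 * s) = k at hk ⊢
  rw [← ENNReal.ofReal_ofNat 2, ← ENNReal.ofReal_mul (by norm_num),
    ← ENNReal.ofReal_mul (by norm_num), ← ENNReal.ofReal_add (by positivity) (by positivity),
    ← ENNReal.ofReal_add (by positivity) (by positivity)]
  congr 1
  ring

/-- Fatou's lemma for the Gagliardo double integral. -/
lemma gagliardo_le_liminf {f : ℕ → EuclideanSpace ℝ (Fin N) → ℝ} (hf : ∀ n, Measurable (f n))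
    (h : ∀ᵐ x, Tendsto (fun n => f n x) atTop (𝓝 (u x))) :
    gagliardo s u ≤ liminf (fun n => gagliardo s (f n)) atTop := by
  have m := fun n => measurable_gagliardo_integrand s (hf n)
  have mi := fun n => (m n).lintegral_prod_right' (ν := volume)
  have hpt : ∀ᵐ x, ∀ᵐ y, ENNReal.ofReal ((u x - u y) ^ 2 / ‖x - y‖ ^ ((N : ℝ) + 2 * s)) ≤
      liminf (fun n => ENNReal.ofReal ((f n x - f n y) ^ 2 / ‖x - y‖ ^ ((N : ℝ) + 2 * s)))
        atTop := by
    filter_upwards [h] with x hx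
    filter_upwards [h] with y hy
    have ht : Tendsto (fun n => (f n x - f n y) ^ 2 / ‖x - y‖ ^ ((N : ℝ) + 2 * s)) atTop
        (𝓝 ((u x - u y) ^ 2 / ‖x - y‖ ^ ((N : ℝ) + 2 * s))) := ((hx.sub hy).pow 2).div_const _
    exact (ENNReal.tendsto_ofReal ht).liminf_eq.ge
  have hin : ∀ᵐ x, ∫⁻ y, ENNReal.ofReal ((u x - u y) ^ 2 / ‖x - y‖ ^ ((N : ℝ) + 2 * s)) ≤
      liminf (fun n => ∫⁻ y, ENNReal.ofReal ((f n x - f n y) ^ 2 /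
        ‖x - y‖ ^ ((N : ℝ) + 2 * s))) atTop := by
    filter_upwards [hpt] with x hx
    have mx : ∀ n, Measurable fun y =>
        ENNReal.ofReal ((f n x - f n y) ^ 2 / ‖x - y‖ ^ ((N : ℝ) + 2 * s)) := by
      intro n
      have := hf n
      fun_prop
    exact (lintegral_mono_ae hx).trans (lintegral_liminf_le mx)
  exact (lintegral_mono_ae hin).trans (lintegral_liminf_le mi)

lemma gagliardo_le_of_tendsto {f : ℕ → EuclideanSpace ℝ (Fin N) → ℝ} (hf : ∀ n, Measurable (f n))
    (h : ∀ᵐ x, Tendsto (fun n => f n x) atTop (𝓝 (u x))) {C : ℝ≥0∞}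
    (hC : ∀ᶠ n in atTop, gagliardo s (f n) ≤ C) : gagliardo s u ≤ C :=
  (gagliardo_le_liminf hf h).trans (liminf_le_of_frequently_le' hC.frequently)

/-- The weighted form of the triangle inequality, with the squared seminorms. -/
lemma gagliardo_le_weighted {ε : ℝ} (hε : 0 < ε) (hu : AEMeasurable u) (hv : AEMeasurable v) :
    gagliardo s v ≤ ENNReal.ofReal (1 + ε) * gagliardo s u +
      ENNReal.ofReal (1 + ε⁻¹) * gagliardo s (u - v) := by
  rw [gagliardo_congr_ae hu.ae_eq_mk, gagliardo_congr_ae hv.ae_eq_mk,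
    gagliardo_congr_ae (hu.ae_eq_mk.sub hv.ae_eq_mk)]
  refine gagliardo_le_of_forall_sq_le (by positivity) (by positivity) hu.measurable_mk
    (hu.measurable_mk.sub hv.measurable_mk) fun x y => ?_
  simp only [Pi.sub_apply]
  generalize hu.mk u x = a
  generalize hu.mk u y = b
  generalize hv.mk v x = c
  generalize hv.mk v y = d
  -- With X the increment of u and Y that of u - v, this is ε X² + 2 X Y + ε⁻¹ Y² ≥ 0, which is the
  -- claim for (X - Y)².
  have key : 0 ≤ ε⁻¹ * (ε * (a - b) + ((a - c) - (b - d))) ^ 2 := by positivity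
  have : ε⁻¹ * (ε * (a - b) + ((a - c) - (b - d))) ^ 2 = ε * (a - b) ^ 2 +
      2 * (a - b) * ((a - c) - (b - d)) + ε⁻¹ * ((a - c) - (b - d)) ^ 2 := by
    field_simp
    ring
  nlinarith [this, key]

/-- Upper semicontinuity along sequences converging in the Gagliardo seminorm. -/
lemma eventually_gagliardo_le_add {f : ℕ → EuclideanSpace ℝ (Fin N) → ℝ}
    (hu : AEMeasurable u) (hf : ∀ n, AEMeasurable (f n)) (hfin : gagliardo s u ≠ ⊤)
    (h : Tendsto (fun n => gagliardo s (u - f n)) atTop (𝓝 0)) {η : ℝ≥0∞} (hη : 0 < η) :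
    ∀ᶠ n in atTop, gagliardo s (f n) ≤ gagliardo s u + η := by
  obtain ⟨ε, hε, hεη⟩ : ∃ ε : ℝ, 0 < ε ∧
      ENNReal.ofReal (1 + ε) * gagliardo s u < gagliardo s u + η := by
    have ht : Tendsto (fun ε : ℝ => ENNReal.ofReal (1 + ε) * gagliardo s u) (𝓝[>] 0)
        (𝓝 (gagliardo s u)) := by
      have : Tendsto (fun ε : ℝ => ENNReal.ofReal (1 + ε)) (𝓝[>] 0) (𝓝 1) := by
        have hc : Continuous fun ε : ℝ => ENNReal.ofReal (1 + ε) :=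
          ENNReal.continuous_ofReal.comp (continuous_const.add continuous_id)
        simpa using (hc.tendsto 0).mono_left nhdsWithin_le_nhds
      simpa using ENNReal.Tendsto.mul_const this (Or.inr hfin)
    have hlt : gagliardo s u < gagliardo s u + η := ENNReal.lt_add_right hfin hη.ne'
    obtain ⟨ε, h1, h2⟩ := ((ht.eventually (gt_mem_nhds hlt)).and self_mem_nhdsWithin).exists
    exact ⟨ε, h2, h1⟩
  have ht : Tendsto (fun n => ENNReal.ofReal (1 + ε) * gagliardo s u +
      ENNReal.ofReal (1 + ε⁻¹) * gagliardo s (u - f n)) atTop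
      (𝓝 (ENNReal.ofReal (1 + ε) * gagliardo s u)) := by
    simpa using (ENNReal.Tendsto.const_mul (a := ENNReal.ofReal (1 + ε⁻¹)) h
      (Or.inr ENNReal.ofReal_ne_top)).const_add (ENNReal.ofReal (1 + ε) * gagliardo s u)
  filter_upwards [ht.eventually (gt_mem_nhds hεη)] with n hn
  exact (gagliardo_le_weighted hε hu (hf n)).trans hn.le

end GagliardoTools

/-! ### Test functions: finite energy and smooth approximation of √(φ² + ψ²) -/

section TestFunctions

variable {N : ℕ} {s q : ℝ} {Ω : Set (EuclideanSpace ℝ (Fin N))}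
  {φ ψ : EuclideanSpace ℝ (Fin N) → ℝ}

namespace IsTestFunction

protected lemma continuous (h : IsTestFunction Ω φ) : Continuous φ := h.smooth.continuous

protected lemma measurable (h : IsTestFunction Ω φ) : Measurable φ := h.continuous.measurable

lemma eq_zero (h : IsTestFunction Ω φ) {x : EuclideanSpace ℝ (Fin N)} (hx : x ∉ Ω) : φ x = 0 :=
  image_eq_zero_of_notMem_tsupport fun hx' => hx (h.supp hx')

protected lemma zero : IsTestFunction Ω (fun _ => (0 : ℝ)) where
  smooth := contDiff_const
  compact := HasCompactSupport.zero
  supp := by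
    have : tsupport (fun _ : EuclideanSpace ℝ (Fin N) => (0 : ℝ)) = ∅ := tsupport_eq_empty_iff.2 rfl
    simp [this]

/-- Smooth functions of two test functions that vanish at the origin are test functions. -/
lemma comp₂ (hφ : IsTestFunction Ω φ) (hψ : IsTestFunction Ω ψ) {G : ℝ → ℝ → ℝ}
    (hG : ContDiff ℝ ∞ fun x => G (φ x) (ψ x)) (h0 : G 0 0 = 0) :
    IsTestFunction Ω (fun x => G (φ x) (ψ x)) := by
  have hsub : tsupport (fun x => G (φ x) (ψ x)) ⊆ tsupport φ ∪ tsupport ψ := by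
    refine closure_minimal (fun x hx => ?_) ((isClosed_tsupport _).union (isClosed_tsupport _))
    by_contra hn
    rw [Set.mem_union, not_or] at hn
    refine hx ?_
    simp only [image_eq_zero_of_notMem_tsupport hn.1, image_eq_zero_of_notMem_tsupport hn.2, h0]
  exact ⟨hG, (hφ.compact.union hψ.compact).of_isClosed_subset (isClosed_tsupport _) hsub,
    hsub.trans (Set.union_subset hφ.supp hψ.supp)⟩

protected lemma add (hφ : IsTestFunction Ω φ) (hψ : IsTestFunction Ω ψ) :
    IsTestFunction Ω (fun x => φ x + ψ x) :=
  hφ.comp₂ hψ (G := fun a b => a + b) (hφ.smooth.add hψ.smooth) (by simp)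

protected lemma const_mul (hφ : IsTestFunction Ω φ) (c : ℝ) :
    IsTestFunction Ω (fun x => c * φ x) :=
  hφ.comp₂ hφ (G := fun a _ => c * a) (contDiff_const.mul hφ.smooth) (by simp)

/-- The term δ² removes the singularity of the root at 0, and subtracting δ restores the value 0 off
the supports. -/
lemma sqrt_regularized (hφ : IsTestFunction Ω φ) (hψ : IsTestFunction Ω ψ) {δ : ℝ} (hδ : 0 < δ) :
    IsTestFunction Ω (fun x => √(φ x ^ 2 + ψ x ^ 2 + δ ^ 2) - δ) := by
  refine hφ.comp₂ hψ (G := fun a b => √(a ^ 2 + b ^ 2 + δ ^ 2) - δ) ?_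
    (by simp [Real.sqrt_sq hδ.le])
  refine ContDiff.sub (ContDiff.sqrt ?_ fun x => by positivity) contDiff_const
  exact ((hφ.smooth.pow 2).add (hψ.smooth.pow 2)).add contDiff_const

end IsTestFunction

/-- In polar coordinates the integrand is r^(1 - 2s) near 0, integrable as s < 1, and r^(-1 - 2s) at
infinity, integrable as s > 0. -/
lemma integrable_min_sq_div_rpow (hN : 1 ≤ N) (hs0 : 0 < s) (hs1 : s < 1) :
    Integrable (fun z : EuclideanSpace ℝ (Fin N) =>
      min 1 (‖z‖ ^ 2) / ‖z‖ ^ ((N : ℝ) + 2 * s)) := by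
  have : Nonempty (Fin N) := ⟨⟨0, hN⟩⟩
  rw [integrable_fun_norm_addHaar volume (f := fun r : ℝ => min 1 (r ^ 2) / r ^ ((N : ℝ) + 2 * s)),
    finrank_euclideanSpace_fin, ← Set.Ioc_union_Ioi_eq_Ioi zero_le_one]
  have hpow : ∀ y : ℝ, 0 < y → y ^ (N - 1) = y ^ ((N : ℝ) - 1) := fun y hy => by
    rw [← Real.rpow_natCast, Nat.cast_sub hN, Nat.cast_one]
  refine IntegrableOn.union ?_ ?_
  · have h : IntegrableOn (fun y : ℝ => y ^ (1 - 2 * s)) (Set.Ioc 0 1) := by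
      rw [← intervalIntegrable_iff_integrableOn_Ioc_of_le zero_le_one]
      exact intervalIntegral.intervalIntegrable_rpow' (by linarith)
    refine h.congr_fun (fun y hy => ?_) measurableSet_Ioc
    have hy0 : 0 < y := hy.1
    beta_reduce
    rw [min_eq_right (by have := hy.2; nlinarith), hpow y hy0, smul_eq_mul, mul_div_assoc',
      ← Real.rpow_natCast y 2, ← Real.rpow_add hy0, ← Real.rpow_sub hy0]
    congr 1
    push_cast
    ring
  · have h : IntegrableOn (fun y : ℝ => y ^ (-1 - 2 * s)) (Set.Ioi 1) :=
      integrableOn_Ioi_rpow_of_lt (by linarith) one_pos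
    refine h.congr_fun (fun y hy => ?_) measurableSet_Ioi
    have hy1 : 1 < y := hy
    have hy0 : 0 < y := one_pos.trans hy1
    beta_reduce
    rw [min_eq_left (by nlinarith), hpow y hy0, smul_eq_mul, mul_one_div, ← Real.rpow_sub hy0]
    congr 1
    ring

/-- The Lipschitz bound tames the diagonal and boundedness the far field; since the increment
vanishes unless x or y lies in the compact support, the integral is at most twice the measure of the
support times a convergent integral in x - y. -/
lemma IsTestFunction.gagliardo_ne_top (h : IsTestFunction Ω φ) (hN : 1 ≤ N) (hs0 : 0 < s)
    (hs1 : s < 1) : gagliardo s φ ≠ ⊤ := by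
  obtain ⟨L, hL⟩ := h.smooth.lipschitzWith_of_hasCompactSupport h.compact (by simp)
  obtain ⟨M, hM⟩ := h.compact.exists_bound_of_continuous h.continuous
  set K := tsupport φ
  set C : ℝ := (2 * M) ^ 2 + (L : ℝ) ^ 2
  have hC : 0 ≤ C := by positivity
  set k : EuclideanSpace ℝ (Fin N) → ℝ≥0∞ := fun z =>
    ENNReal.ofReal (C * (min 1 (‖z‖ ^ 2) / ‖z‖ ^ ((N : ℝ) + 2 * s))) with hk
  have hkm : Measurable k := by fun_prop
  have hKm : MeasurableSet K := (isClosed_tsupport φ).measurableSet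
  have hkfin : ∫⁻ z, k z ≠ ⊤ := by
    have := ((integrable_min_sq_div_rpow hN hs0 hs1).const_mul C).lintegral_lt_top
    exact this.ne
  set I := ∫⁻ z, k z
  have hsq : ∀ x y, (φ x - φ y) ^ 2 ≤ C * min 1 (‖x - y‖ ^ 2) := by
    intro x y
    have h1 : |φ x - φ y| ≤ 2 * M := by
      have hx := hM x
      have hy := hM y
      rw [Real.norm_eq_abs] at hx hy
      have := abs_sub (φ x) (φ y)
      linarith
    have h2 : |φ x - φ y| ≤ L * ‖x - y‖ := by
      have := hL.dist_le_mul x y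
      rwa [Real.dist_eq, dist_eq_norm] at this
    have h1' : (φ x - φ y) ^ 2 ≤ (2 * M) ^ 2 := by rw [← sq_abs]; gcongr
    have h2' : (φ x - φ y) ^ 2 ≤ (L : ℝ) ^ 2 * ‖x - y‖ ^ 2 := by
      rw [← sq_abs, ← mul_pow]; gcongr
    rcases min_choice 1 (‖x - y‖ ^ 2) with hm | hm <;> rw [hm]
    · have := sq_nonneg (L : ℝ)
      linarith
    · have : (2 * M) ^ 2 * ‖x - y‖ ^ 2 ≥ 0 := by positivity
      rw [add_mul]
      linarith
  have hpt : ∀ x y, ENNReal.ofReal ((φ x - φ y) ^ 2 / ‖x - y‖ ^ ((N : ℝ) + 2 * s)) ≤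
      K.indicator 1 x * k (x - y) + K.indicator 1 y * k (x - y) := by
    intro x y
    have hle : ENNReal.ofReal ((φ x - φ y) ^ 2 / ‖x - y‖ ^ ((N : ℝ) + 2 * s)) ≤ k (x - y) := by
      refine ENNReal.ofReal_le_ofReal ?_
      rw [← mul_div_assoc]
      exact div_le_div_of_nonneg_right (hsq x y) (by positivity)
    by_cases hx : x ∈ K
    · simpa [hx] using hle.trans le_self_add
    by_cases hy : y ∈ K
    · simpa [hx, hy] using hle
    · simp [image_eq_zero_of_notMem_tsupport hx, image_eq_zero_of_notMem_tsupport hy]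
  have hind : Measurable (K.indicator (1 : EuclideanSpace ℝ (Fin N) → ℝ≥0∞)) :=
    measurable_one.indicator hKm
  have hKI : ∫⁻ x, K.indicator (1 : EuclideanSpace ℝ (Fin N) → ℝ≥0∞) x * I ≠ ⊤ := by
    rw [lintegral_mul_const _ hind, lintegral_indicator_one hKm]
    exact ENNReal.mul_ne_top h.compact.isCompact.measure_lt_top.ne hkfin
  have h1 : ∫⁻ x, ∫⁻ y, K.indicator 1 x * k (x - y) ≠ ⊤ := by
    have : ∀ x, ∫⁻ y, K.indicator 1 x * k (x - y) = K.indicator 1 x * I := fun x => by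
      rw [lintegral_const_mul _ (by fun_prop), lintegral_sub_left_eq_self]
    simpa only [this] using hKI
  have h2 : ∫⁻ x, ∫⁻ y, K.indicator 1 y * k (x - y) ≠ ⊤ := by
    rw [lintegral_lintegral_swap]
    · have : ∀ y, ∫⁻ x, K.indicator 1 y * k (x - y) = K.indicator 1 y * I := fun y => by
        rw [lintegral_const_mul _ (by fun_prop), lintegral_sub_right_eq_self]
      simpa only [this] using hKI
    · refine Measurable.aemeasurable ?_
      exact (hind.comp measurable_snd).mul (hkm.comp (measurable_fst.sub measurable_snd))
  refine ne_top_of_le_ne_top (ENNReal.add_ne_top.2 ⟨h1, h2⟩) ?_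
  rw [← lintegral_add_left]
  · refine lintegral_mono fun x => ?_
    rw [← lintegral_add_left (by fun_prop)]
    exact lintegral_mono fun y => hpt x y
  · refine Measurable.lintegral_prod_right' (f := fun p : EuclideanSpace ℝ (Fin N) ×
      EuclideanSpace ℝ (Fin N) => K.indicator 1 p.1 * k (p.1 - p.2)) ?_
    exact (hind.comp measurable_fst).mul (hkm.comp (measurable_fst.sub measurable_snd))

/-- `(φ² + ψ²)^(q/2)` is integrable for test functions `φ` and `ψ`. -/
lemma IsTestFunction.integrable_rpow (hφ : IsTestFunction Ω φ) (hψ : IsTestFunction Ω ψ)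
    (hq : 0 < q) : Integrable (fun x => (φ x ^ 2 + ψ x ^ 2) ^ (q / 2)) := by
  refine Continuous.integrable_of_hasCompactSupport ?_ ?_
  · exact ((hφ.continuous.pow 2).add (hψ.continuous.pow 2)).rpow_const fun x => Or.inr (by positivity)
  · refine (hφ.compact.union hψ.compact).of_isClosed_subset (isClosed_tsupport _) ?_
    refine closure_minimal (fun x hx => ?_) ((isClosed_tsupport _).union (isClosed_tsupport _))
    by_contra hn
    rw [Set.mem_union, not_or] at hn
    refine hx ?_
    simp only [image_eq_zero_of_notMem_tsupport hn.1, image_eq_zero_of_notMem_tsupport hn.2]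
    simp [hq.ne']

lemma abs_rpow_eq (a q : ℝ) : |a| ^ q = (a ^ 2) ^ (q / 2) := by
  rw [← sq_abs, ← Real.rpow_natCast, ← Real.rpow_mul (abs_nonneg _)]
  congr 1
  push_cast
  ring

lemma IsTestFunction.integrable_abs_rpow (hφ : IsTestFunction Ω φ) (hq : 0 < q) :
    Integrable (fun x => |φ x| ^ q) := by
  simpa [abs_rpow_eq] using hφ.integrable_rpow (IsTestFunction.zero (Ω := Ω)) hq

lemma IsTestFunction.powerIntegral_ne_top (hφ : IsTestFunction Ω φ) (hq : 0 < q) :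
    powerIntegral q Ω φ ≠ ⊤ :=
  ((hφ.integrable_abs_rpow hq).restrict.lintegral_lt_top).ne

/-- Reverse triangle inequality for the vectors (a, b, δ) and (c, d, δ) of ℝ³; `hAB` is
Cauchy-Schwarz, and the third coordinates cancel. -/
lemma sq_sqrt_regularized_sub_le (a b c d δ : ℝ) :
    (√(a ^ 2 + b ^ 2 + δ ^ 2) - δ - (√(c ^ 2 + d ^ 2 + δ ^ 2) - δ)) ^ 2 ≤
      1 * (a - c) ^ 2 + 1 * (b - d) ^ 2 := by
  set A := √(a ^ 2 + b ^ 2 + δ ^ 2) with hA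
  set B := √(c ^ 2 + d ^ 2 + δ ^ 2) with hB
  have hA2 : A ^ 2 = a ^ 2 + b ^ 2 + δ ^ 2 := Real.sq_sqrt (by positivity)
  have hB2 : B ^ 2 = c ^ 2 + d ^ 2 + δ ^ 2 := Real.sq_sqrt (by positivity)
  have hAB : a * c + b * d + δ ^ 2 ≤ A * B := by
    refine (le_abs_self _).trans (abs_le_of_sq_le_sq ?_ (by positivity))
    rw [mul_pow, hA2, hB2]
    nlinarith [sq_nonneg (a * d - b * c), sq_nonneg (δ * (a - c)), sq_nonneg (δ * (b - d))]
  nlinarith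

/-- Non-negative test functions approximate `√(φ² + ψ²)` without exceeding the sum of the
Gagliardo energies of `φ` and `ψ`. -/
lemma exists_isTestFunction_nonneg_approx (hq : 0 < q) (hφ : IsTestFunction Ω φ)
    (hψ : IsTestFunction Ω ψ) {C : ℝ≥0∞}
    (hC : C < ∫⁻ x in Ω, ENNReal.ofReal ((φ x ^ 2 + ψ x ^ 2) ^ (q / 2))) :
    ∃ g, IsTestFunction Ω g ∧ (∀ x, 0 ≤ g x) ∧ gagliardo s g ≤ gagliardo s φ + gagliardo s ψ ∧
      C < powerIntegral q Ω g := by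
  set δ : ℕ → ℝ := fun n => 1 / ((n : ℝ) + 1)
  have hδ : ∀ n, 0 < δ n := fun n => by positivity
  set g : ℕ → EuclideanSpace ℝ (Fin N) → ℝ := fun n x => √(φ x ^ 2 + ψ x ^ 2 + δ n ^ 2) - δ n
  have hg : ∀ n, IsTestFunction Ω (g n) := fun n => hφ.sqrt_regularized hψ (hδ n)
  have hlim : ∀ x, Tendsto (fun n => ENNReal.ofReal (|g n x| ^ q)) atTop
      (𝓝 (ENNReal.ofReal ((φ x ^ 2 + ψ x ^ 2) ^ (q / 2)))) := by
    intro x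
    refine ENNReal.tendsto_ofReal ?_
    have hδ0 : Tendsto δ atTop (𝓝 0) := tendsto_one_div_add_atTop_nhds_zero_nat
    have hc : Continuous fun t : ℝ => |√(φ x ^ 2 + ψ x ^ 2 + t ^ 2) - t| ^ q := by
      refine Continuous.rpow_const (by fun_prop) fun _ => Or.inr hq.le
    have := (hc.tendsto 0).comp hδ0
    rwa [sub_zero, abs_rpow_eq, Real.sq_sqrt (by positivity), zero_pow two_ne_zero, add_zero]
      at this
  have hfatou : ∫⁻ x in Ω, ENNReal.ofReal ((φ x ^ 2 + ψ x ^ 2) ^ (q / 2)) ≤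
      liminf (fun n => powerIntegral q Ω (g n)) atTop := by
    refine le_trans (lintegral_mono fun x => (hlim x).liminf_eq.ge) (lintegral_liminf_le fun n => ?_)
    have := (hg n).measurable
    fun_prop
  obtain ⟨n, hn⟩ := (eventually_lt_of_lt_liminf (hC.trans_le hfatou)).exists
  refine ⟨g n, hg n, fun x => ?_, ?_, hn⟩
  · refine sub_nonneg.2 (Real.le_sqrt_of_sq_le ?_)
    have := sq_nonneg (φ x)
    have := sq_nonneg (ψ x)
    linarith
  · have := gagliardo_le_of_forall_sq_le (s := s) (g := g n) zero_le_one zero_le_one hφ.measurable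
      hψ.measurable fun x y => sq_sqrt_regularized_sub_le (φ x) (ψ x) (φ y) (ψ y) (δ n)
    simpa using this

end TestFunctions

/-! ### Uniform concavity of powers and coercivity -/

section Coercivity

variable {N : ℕ} {s q : ℝ} {Ω : Set (EuclideanSpace ℝ (Fin N))}
  {φ ψ : EuclideanSpace ℝ (Fin N) → ℝ}

/-! ### Uniform concavity of powers -/

/-- On (0, 1) the second derivative of t^p is p (p - 1) t^(p - 2) ≤ -p (1 - p), so there is room for
this quadratic term: t^p is strongly concave on [0, 1]. -/
lemma concaveOn_rpow_add_mul_sq {p : ℝ} (hp0 : 0 < p) (hp1 : p < 1) :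
    ConcaveOn ℝ (Set.Icc 0 1) fun t : ℝ => t ^ p + p * (1 - p) / 2 * t ^ 2 := by
  refine concaveOn_of_hasDerivWithinAt2_nonpos (convex_Icc 0 1)
    (f' := fun t => p * t ^ (p - 1) + p * (1 - p) * t)
    (f'' := fun t => p * ((p - 1) * t ^ (p - 1 - 1)) + p * (1 - p)) ?_ ?_ ?_ ?_
  · exact ((Real.continuous_rpow_const hp0.le).add (by fun_prop)).continuousOn
  · intro t ht
    rw [interior_Icc] at ht ⊢
    have h1 := Real.hasDerivAt_rpow_const (x := t) (p := p) (Or.inl ht.1.ne')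
    have h2 := ((hasDerivAt_id t).pow 2).const_mul (p * (1 - p) / 2)
    refine ((h1.add h2).congr_deriv ?_).hasDerivWithinAt
    simp
    ring
  · intro t ht
    rw [interior_Icc] at ht ⊢
    have h1 := (Real.hasDerivAt_rpow_const (x := t) (p := p - 1) (Or.inl ht.1.ne')).const_mul p
    have h2 := (hasDerivAt_id t).const_mul (p * (1 - p))
    refine ((h1.add h2).congr_deriv ?_).hasDerivWithinAt
    simp
  · intro t ht
    rw [interior_Icc] at ht
    have h1 : 1 ≤ t ^ (p - 1 - 1) :=
      Real.one_le_rpow_of_pos_of_le_one_of_nonpos ht.1 ht.2.le (by linarith)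
    have h2 : 0 < p * (1 - p) := mul_pos hp0 (by linarith)
    nlinarith

lemma sq_le_rpow_midpoint_gap {p t : ℝ} (hp0 : 0 < p) (hp1 : p < 1) (ht0 : 0 ≤ t) (ht1 : t ≤ 1) :
    p * (1 - p) / 8 * (1 - t) ^ 2 ≤ ((1 + t) / 2) ^ p - (1 + t ^ p) / 2 := by
  have h := (concaveOn_rpow_add_mul_sq hp0 hp1).2 (Set.right_mem_Icc.2 zero_le_one) ⟨ht0, ht1⟩
    (by norm_num : (0 : ℝ) ≤ 1 / 2) (by norm_num : (0 : ℝ) ≤ 1 / 2) (by norm_num)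
  simp only [smul_eq_mul, Real.one_rpow] at h
  rw [show (1 / 2 : ℝ) * 1 + 1 / 2 * t = (1 + t) / 2 by ring] at h
  nlinarith

/-- By homogeneity take the larger number to be 1 and the smaller t. Then 1 - t^p ≤ 1 - t ≤ ε + (1 -
t)²/(4ε), and strong concavity bounds (1 - t)² by the midpoint gap divided by κ; hence the constant
1/(4εκ). -/
lemma exists_abs_sub_le_rpow_midpoint_gap {p ε : ℝ} (hp0 : 0 < p) (hp1 : p < 1) (hε : 0 < ε) :
    ∃ C, 0 ≤ C ∧ ∀ a b : ℝ, 0 ≤ a → 0 ≤ b →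
      |a ^ p - b ^ p| ≤ ε * (a ^ p + b ^ p) + C * (((a + b) / 2) ^ p - (a ^ p + b ^ p) / 2) := by
  have hκ : 0 < p * (1 - p) / 8 := by
    have := mul_pos hp0 (sub_pos.2 hp1)
    positivity
  set κ := p * (1 - p) / 8
  refine ⟨(4 * ε * κ)⁻¹, by positivity, ?_⟩
  have key : ∀ a b : ℝ, 0 ≤ a → a ≤ b → |a ^ p - b ^ p| ≤ ε * (a ^ p + b ^ p) +
      (4 * ε * κ)⁻¹ * (((a + b) / 2) ^ p - (a ^ p + b ^ p) / 2) := by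
    intro a b ha hab
    rcases (ha.trans hab).eq_or_lt with hb | hb
    · have : a = 0 := by linarith
      subst this
      subst hb
      simp [Real.zero_rpow hp0.ne']
    obtain ⟨t, rfl⟩ : ∃ t, a = t * b := ⟨a / b, (div_mul_cancel₀ _ hb.ne').symm⟩
    have ht0 : 0 ≤ t := nonneg_of_mul_nonneg_left ha hb
    have ht1 : t ≤ 1 := by nlinarith
    have hgap := sq_le_rpow_midpoint_gap hp0 hp1 ht0 ht1
    have htp : t ≤ t ^ p := by
      simpa using Real.rpow_le_rpow_of_exponent_ge' ht0 ht1 hp0.le hp1.le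
    have htp1 : t ^ p ≤ 1 := Real.rpow_le_one ht0 ht1 hp0.le
    rw [show (t * b + b) / 2 = (1 + t) / 2 * b by ring, Real.mul_rpow ht0 hb.le,
      Real.mul_rpow (by positivity : 0 ≤ (1 + t) / 2) hb.le]
    have hbp : 0 < b ^ p := Real.rpow_pos_of_pos hb p
    have h1 : 1 - t ^ p ≤ ε * (t ^ p + 1) +
        (4 * ε * κ)⁻¹ * (((1 + t) / 2) ^ p - (t ^ p + 1) / 2) := by
      have h2 : (4 * ε * κ)⁻¹ * (κ * (1 - t) ^ 2) ≤
          (4 * ε * κ)⁻¹ * (((1 + t) / 2) ^ p - (t ^ p + 1) / 2) := by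
        gcongr
        rw [add_comm (t ^ p)]
        exact hgap
      have h3 : (4 * ε * κ)⁻¹ * (κ * (1 - t) ^ 2) = (4 * ε)⁻¹ * (1 - t) ^ 2 := by
        field_simp
      have h4 : 1 - t ≤ ε + (4 * ε)⁻¹ * (1 - t) ^ 2 := by
        have : ε + (4 * ε)⁻¹ * (1 - t) ^ 2 - (1 - t) = (4 * ε)⁻¹ * (1 - t - 2 * ε) ^ 2 := by
          field_simp
          ring
        have : 0 ≤ (4 * ε)⁻¹ * (1 - t - 2 * ε) ^ 2 := by positivity
        linarith
      have h5 : ε ≤ ε * (t ^ p + 1) := by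
        have := mul_nonneg hε.le (ht0.trans htp)
        linarith
      linarith
    rw [abs_of_nonpos (by nlinarith)]
    have h6 := mul_le_mul_of_nonneg_right h1 hbp.le
    calc -(t ^ p * b ^ p - b ^ p) = (1 - t ^ p) * b ^ p := by ring
      _ ≤ _ := h6
      _ = _ := by ring
  intro a b ha hb
  rcases le_total a b with hab | hab
  · exact key a b ha hab
  · have := key b a hb hab
    rwa [abs_sub_comm, add_comm b a, add_comm (b ^ p)] at this

/-! ### Coercivity of the free energy -/

lemma powerIntegral_const_mul (c : ℝ) (u : EuclideanSpace ℝ (Fin N) → ℝ) :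
    powerIntegral q Ω (fun x => c * u x) = ENNReal.ofReal (|c| ^ q) * powerIntegral q Ω u := by
  unfold powerIntegral
  rw [← lintegral_const_mul' _ _ ENNReal.ofReal_ne_top]
  refine lintegral_congr fun x => ?_
  rw [← ENNReal.ofReal_mul (by positivity), abs_mul, Real.mul_rpow (abs_nonneg _) (abs_nonneg _)]

lemma exists_mul_rpow_le_gagliardo (hN : 1 ≤ N) (hs0 : 0 < s) (hs1 : s < 1) (hq : 0 < q)
    (hl : 0 < lambda1 s q Ω) :
    ∃ c : ℝ, 0 < c ∧ ∀ φ, IsTestFunction Ω φ →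
      c * (powerIntegral q Ω φ).toReal ^ (2 / q) ≤ (gagliardo s φ).toReal := by
  obtain ⟨c, hc0, hcl⟩ := ENNReal.lt_iff_exists_nnreal_btwn.1 hl
  refine ⟨c, by simpa using hc0, fun φ hφ => ?_⟩
  set P := (powerIntegral q Ω φ).toReal with hP
  have hPeq : powerIntegral q Ω φ = ENNReal.ofReal P :=
    (ENNReal.ofReal_toReal (hφ.powerIntegral_ne_top hq)).symm
  have hYeq := (ENNReal.ofReal_toReal (hφ.gagliardo_ne_top hN hs0 hs1)).symm
  rcases (ENNReal.toReal_nonneg : 0 ≤ P).eq_or_lt with h0 | hpos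
  · rw [hP, ← h0, Real.zero_rpow (by positivity), mul_zero]
    exact ENNReal.toReal_nonneg
  -- The multiple P^(-1/q) φ has power integral 1, so it competes in λ₁.
  have ht : 0 < P ^ (-1 / q) := Real.rpow_pos_of_pos hpos _
  have h1 : powerIntegral q Ω (fun x => P ^ (-1 / q) * φ x) = 1 := by
    rw [powerIntegral_const_mul, hPeq, ← ENNReal.ofReal_mul (by positivity), abs_of_pos ht,
      ← Real.rpow_mul hpos.le, div_mul_cancel₀ _ hq.ne', Real.rpow_neg_one,
      inv_mul_cancel₀ hpos.ne', ENNReal.ofReal_one]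
  have h2 : lambda1 s q Ω ≤ gagliardo s (fun x => P ^ (-1 / q) * φ x) :=
    iInf₂_le_of_le _ (hφ.const_mul _) (iInf_le_of_le h1 le_rfl)
  rw [gagliardo_const_mul, hYeq, ← ENNReal.ofReal_mul (by positivity)] at h2
  have h3 := (hcl.le.trans h2)
  rw [ENNReal.le_ofReal_iff_toReal_le ENNReal.coe_ne_top (by positivity)] at h3
  have h4 : P ^ (2 / q) * (P ^ (-1 / q)) ^ 2 = 1 := by
    rw [← Real.rpow_natCast, ← Real.rpow_mul hpos.le, ← Real.rpow_add hpos]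
    rw [show 2 / q + -1 / q * ((2 : ℕ) : ℝ) = 0 by push_cast; ring, Real.rpow_zero]
  have h5 := mul_le_mul_of_nonneg_right h3 (Real.rpow_nonneg hpos.le (2 / q))
  calc (c : ℝ) * P ^ (2 / q) ≤ _ := h5
    _ = (P ^ (2 / q) * (P ^ (-1 / q)) ^ 2) * (gagliardo s φ).toReal := by ring
    _ = _ := by rw [h4, one_mul]

lemma exists_le_mul_rpow_add {A r : ℝ} (hA : 0 < A) (hr : 1 < r) :
    ∃ C, 0 ≤ C ∧ ∀ t : ℝ, 0 ≤ t → t ≤ A * t ^ r + C := by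
  -- The constant is the positive solution of A t^r = t: below it t ≤ C, above it t ≤ A t^r.
  refine ⟨(A⁻¹) ^ (1 / (r - 1)), by positivity, fun t ht => ?_⟩
  rcases le_total t ((A⁻¹) ^ (1 / (r - 1))) with h | h
  · have : 0 ≤ A * t ^ r := by positivity
    linarith
  · have hpos : 0 < (A⁻¹) ^ (1 / (r - 1)) := by positivity
    have ht0 : 0 < t := hpos.trans_le h
    have h1 : A⁻¹ ≤ t ^ (r - 1) := by
      have := Real.rpow_le_rpow hpos.le h (sub_pos.2 hr).le
      rwa [← Real.rpow_mul (by positivity), one_div_mul_cancel (sub_pos.2 hr).ne',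
        Real.rpow_one] at this
    have h2 : t ^ r = t ^ (r - 1) * t := by
      rw [← Real.rpow_add_one ht0.ne', sub_add_cancel]
    have h3 : A * (A⁻¹ * t) ≤ A * t ^ r := by rw [h2]; gcongr
    rw [mul_inv_cancel_left₀ hA.ne'] at h3
    linarith

/-- As q < 2, the power integral grows slower than the energy. The factor 1/4 < 1/2 bounds F below
and leaves a margin that bounds the power integrals of almost minimisers. -/
lemma exists_powerIntegral_le (hN : 1 ≤ N) (hs0 : 0 < s) (hs1 : s < 1) (hq : 0 < q) (hq2 : q < 2)
    (hl : 0 < lambda1 s q Ω) :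
    ∃ C, 0 ≤ C ∧ ∀ φ, IsTestFunction Ω φ →
      1 / q * (powerIntegral q Ω φ).toReal ≤ 1 / 4 * (gagliardo s φ).toReal + C := by
  obtain ⟨c, hc, h⟩ := exists_mul_rpow_le_gagliardo hN hs0 hs1 hq hl
  obtain ⟨C, hC, h'⟩ := exists_le_mul_rpow_add (A := q * c / 4) (r := 2 / q) (by positivity)
    ((one_lt_div hq).2 hq2)
  refine ⟨1 / q * C, by positivity, fun φ hφ => ?_⟩
  have h1 := h φ hφ
  have h2 := mul_le_mul_of_nonneg_left (h' _ (ENNReal.toReal_nonneg (a := powerIntegral q Ω φ)))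
    (by positivity : 0 ≤ 1 / q)
  have h3 : 1 / q * (q * c / 4 * (powerIntegral q Ω φ).toReal ^ (2 / q) + C) =
      1 / 4 * (c * (powerIntegral q Ω φ).toReal ^ (2 / q)) + 1 / q * C := by
    field_simp
  linarith

end Coercivity

/-! ### Hidden convexity and closeness of almost minimisers -/

section AlmostMinimizers

variable {N : ℕ} {s q : ℝ} {Ω : Set (EuclideanSpace ℝ (Fin N))}
  {φ ψ : EuclideanSpace ℝ (Fin N) → ℝ}

lemma IsTestFunction.toReal_powerIntegral (hφ : IsTestFunction Ω φ) :
    (powerIntegral q Ω φ).toReal = ∫ x in Ω, |φ x| ^ q := by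
  have := hφ.measurable
  rw [integral_eq_lintegral_of_nonneg_ae (Eventually.of_forall fun x => by positivity)
    (Measurable.aestronglyMeasurable (by fun_prop)), powerIntegral]

lemma IsTestFunction.toReal_lintegral (hφ : IsTestFunction Ω φ) (hψ : IsTestFunction Ω ψ) :
    (∫⁻ x in Ω, ENNReal.ofReal ((φ x ^ 2 + ψ x ^ 2) ^ (q / 2))).toReal =
      ∫ x in Ω, (φ x ^ 2 + ψ x ^ 2) ^ (q / 2) := by
  have := hφ.measurable
  have := hψ.measurable
  rw [integral_eq_lintegral_of_nonneg_ae (Eventually.of_forall fun x => by positivity)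
    (Measurable.aestronglyMeasurable (by fun_prop))]

lemma freeEnergy_zero (hq : 0 < q) : freeEnergy s q Ω (fun _ => 0) = 0 := by
  simp [freeEnergy, powerIntegral, Real.zero_rpow hq.ne']

/-- Hidden convexity: `√(φ² + ψ²)` is an admissible competitor whose Gagliardo energy is at most the
sum of those of `φ` and `ψ`. -/
lemma add_lintegral_le_of_forall_le_freeEnergy (hN : 1 ≤ N) (hs0 : 0 < s) (hs1 : s < 1) (hq : 0 < q)
    {m : ℝ} (hm : ∀ g, IsTestFunction Ω g → (∀ x, 0 ≤ g x) → m ≤ freeEnergy s q Ω g)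
    (hφ : IsTestFunction Ω φ) (hψ : IsTestFunction Ω ψ) :
    m + 1 / q * (∫⁻ x in Ω, ENNReal.ofReal ((φ x ^ 2 + ψ x ^ 2) ^ (q / 2))).toReal ≤
      1 / 2 * ((gagliardo s φ).toReal + (gagliardo s ψ).toReal) := by
  by_contra! hlt
  set I := ∫⁻ x in Ω, ENNReal.ofReal ((φ x ^ 2 + ψ x ^ 2) ^ (q / 2)) with hI
  have hIfin : I ≠ ⊤ := ((hφ.integrable_rpow hψ hq).restrict.lintegral_lt_top).ne
  set Y := (gagliardo s φ).toReal + (gagliardo s ψ).toReal with hY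
  have hm0 : m ≤ 0 := by
    simpa [freeEnergy_zero hq] using hm _ IsTestFunction.zero fun x => le_rfl
  have hY0 : 0 ≤ Y := by positivity
  -- A smooth competitor whose power integral exceeds q (Y/2 - m) and whose Gagliardo energy is at
  -- most Y would have free energy below m.
  have hC : ENNReal.ofReal (q * (1 / 2 * Y - m)) < I := by
    rw [ENNReal.ofReal_lt_iff_lt_toReal (mul_nonneg hq.le (by linarith)) hIfin]
    have := mul_lt_mul_of_pos_left (sub_lt_iff_lt_add'.2 hlt) hq
    rwa [← mul_assoc, mul_one_div_cancel hq.ne', one_mul] at this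
  obtain ⟨g, hg, hg0, hgY, hgP⟩ := exists_isTestFunction_nonneg_approx (s := s) hq hφ hψ hC
  rw [ENNReal.ofReal_lt_iff_lt_toReal (mul_nonneg hq.le (by linarith))
    (hg.powerIntegral_ne_top hq)] at hgP
  have h1 : (gagliardo s g).toReal ≤ Y := by
    rw [hY, ← ENNReal.toReal_add (hφ.gagliardo_ne_top hN hs0 hs1) (hψ.gagliardo_ne_top hN hs0 hs1)]
    exact ENNReal.toReal_mono (ENNReal.add_ne_top.2 ⟨hφ.gagliardo_ne_top hN hs0 hs1,
      hψ.gagliardo_ne_top hN hs0 hs1⟩) hgY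
  have h2 := hm g hg hg0
  have h3 := mul_lt_mul_of_pos_left hgP (one_div_pos.2 hq)
  rw [← mul_assoc, one_div_mul_cancel hq.ne', one_mul] at h3
  unfold freeEnergy at h2
  linarith

/-- The midpoint is at least min(a, b), whose q-th power is the mean of a^q and b^q minus half their
distance. -/
lemma rpow_midpoint_ge {a b : ℝ} (ha : 0 ≤ a) (hb : 0 ≤ b) (hq : 0 < q) :
    (a ^ q + b ^ q) / 2 - |a ^ q - b ^ q| / 2 ≤ |1 / 2 * (a + b)| ^ q := by
  rw [abs_of_nonneg (by positivity : 0 ≤ 1 / 2 * (a + b))]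
  rcases le_total a b with h | h
  · have h1 := Real.rpow_le_rpow ha h hq.le
    have h2 := Real.rpow_le_rpow ha (by linarith : a ≤ 1 / 2 * (a + b)) hq.le
    rw [abs_of_nonpos (by linarith)]
    linarith
  · have h1 := Real.rpow_le_rpow hb h hq.le
    have h2 := Real.rpow_le_rpow hb (by linarith : b ≤ 1 / 2 * (a + b)) hq.le
    rw [abs_of_nonneg (by linarith)]
    linarith

/-- The parallelogram law controls the Gagliardo distance of two almost minimisers by the
`L¹` distance of their `q`-th powers. -/
lemma gagliardo_sub_le_of_le_freeEnergy (hN : 1 ≤ N) (hs0 : 0 < s) (hs1 : s < 1) (hq : 0 < q)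
    {m : ℝ} (hm : ∀ g, IsTestFunction Ω g → (∀ x, 0 ≤ g x) → m ≤ freeEnergy s q Ω g)
    (hφ : IsTestFunction Ω φ) (hψ : IsTestFunction Ω ψ) (hφ0 : ∀ x, 0 ≤ φ x) (hψ0 : ∀ x, 0 ≤ ψ x) :
    (gagliardo s (fun x => φ x - ψ x)).toReal ≤
      8 * ((freeEnergy s q Ω φ + freeEnergy s q Ω ψ) / 2 - m) +
        4 / q * ∫ x in Ω, |(|φ x| ^ q - |ψ x| ^ q)| := by
  set f : EuclideanSpace ℝ (Fin N) → ℝ := fun x => 1 / 2 * (φ x + ψ x) with hf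
  have hft : IsTestFunction Ω f := (hφ.add hψ).const_mul _
  have h1 := hm f hft fun x => mul_nonneg (by norm_num) (add_nonneg (hφ0 x) (hψ0 x))
  have hYφ := hφ.gagliardo_ne_top hN hs0 hs1
  have hYψ := hψ.gagliardo_ne_top hN hs0 hs1
  have hYa := (hφ.add hψ).gagliardo_ne_top hN hs0 hs1
  have hYs : gagliardo s (fun x => φ x - ψ x) ≠ ⊤ := by
    simpa [sub_eq_add_neg] using (hφ.add (hψ.const_mul (-1))).gagliardo_ne_top hN hs0 hs1
  have hpar := congrArg ENNReal.toReal
    (gagliardo_parallelogram (s := s) hφ.measurable hψ.measurable)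
  rw [ENNReal.toReal_add hYa hYs, ENNReal.toReal_add (ENNReal.mul_ne_top (by simp) hYφ)
    (ENNReal.mul_ne_top (by simp) hYψ), ENNReal.toReal_mul, ENNReal.toReal_mul,
    ENNReal.toReal_ofNat] at hpar
  have hYf : (gagliardo s f).toReal = 1 / 4 * (gagliardo s (fun x => φ x + ψ x)).toReal := by
    rw [hf, gagliardo_const_mul, ENNReal.toReal_mul, ENNReal.toReal_ofReal (by positivity)]
    norm_num
  have iφ := (hφ.integrable_abs_rpow hq).restrict (s := Ω)
  have iψ := (hψ.integrable_abs_rpow hq).restrict (s := Ω)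
  have ia : Integrable (fun x => |φ x| ^ q + |ψ x| ^ q) (volume.restrict Ω) := iφ.add iψ
  have ia2 : Integrable (fun x => (|φ x| ^ q + |ψ x| ^ q) / 2) (volume.restrict Ω) :=
    ia.div_const 2
  have id : Integrable (fun x => |(|φ x| ^ q - |ψ x| ^ q)|) (volume.restrict Ω) :=
    (iφ.sub iψ).abs
  have hP : ((powerIntegral q Ω φ).toReal + (powerIntegral q Ω ψ).toReal) / 2 -
      (∫ x in Ω, |(|φ x| ^ q - |ψ x| ^ q)|) / 2 ≤ (powerIntegral q Ω f).toReal := by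
    rw [hφ.toReal_powerIntegral, hψ.toReal_powerIntegral, hft.toReal_powerIntegral,
      ← integral_add iφ iψ, ← integral_div, ← integral_div,
      ← integral_sub ia2 (id.div_const 2)]
    refine integral_mono (ia2.sub (id.div_const 2))
      (hft.integrable_abs_rpow hq).restrict fun x => ?_
    have := rpow_midpoint_ge (hφ0 x) (hψ0 x) hq
    simpa only [abs_of_nonneg (hφ0 x), abs_of_nonneg (hψ0 x)] using this
  have h2 := mul_le_mul_of_nonneg_left hP (one_div_pos.2 hq).le
  have h3 : 4 / q * ∫ x in Ω, |(|φ x| ^ q - |ψ x| ^ q)| =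
      8 * (1 / q * ((∫ x in Ω, |(|φ x| ^ q - |ψ x| ^ q)|) / 2)) := by ring
  rw [h3]
  unfold freeEnergy at h1 ⊢
  rw [hYf] at h1
  linarith

lemma exists_modulus_of_le_freeEnergy (hN : 1 ≤ N) (hs0 : 0 < s) (hs1 : s < 1) (hq : 0 < q)
    (hq2 : q < 2) (hl : 0 < lambda1 s q Ω) {m : ℝ}
    (hm : ∀ g, IsTestFunction Ω g → (∀ x, 0 ≤ g x) → m ≤ freeEnergy s q Ω g)
    {η : ℝ} (hη : 0 < η) :
    ∃ δ > 0, ∀ φ ψ, IsTestFunction Ω φ → IsTestFunction Ω ψ → (∀ x, 0 ≤ φ x) → (∀ x, 0 ≤ ψ x) →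
      freeEnergy s q Ω φ ≤ m + δ → freeEnergy s q Ω ψ ≤ m + δ →
      ∫ x in Ω, |(|φ x| ^ q - |ψ x| ^ q)| ≤ η ∧
      (gagliardo s (fun x => φ x - ψ x)).toReal ≤ 8 * η + 4 / q * η := by
  obtain ⟨C, hC, hcoer⟩ := exists_powerIntegral_le hN hs0 hs1 hq hq2 hl
  have hm0 : m ≤ 0 := by
    simpa [freeEnergy_zero hq] using hm _ IsTestFunction.zero fun x => le_rfl
  -- Almost minimisers have power integral at most B, by coercivity and F ≤ m + δ ≤ 1. Then ε · 2B =
  -- η/2, and δ is taken so that K q δ ≤ η/2; the 1 in its denominator covers K = 0.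
  set B := q * (1 + 2 * C) with hB
  have hBpos : 0 < B := by positivity
  set ε := η / (4 * B) with hε
  obtain ⟨K, hK, hgap⟩ := exists_abs_sub_le_rpow_midpoint_gap (p := q / 2) (ε := ε) (by linarith)
    (by linarith) (by positivity)
  refine ⟨min 1 (min η (η / (2 * (K * q + 1)))), by positivity, ?_⟩
  set δ := min 1 (min η (η / (2 * (K * q + 1)))) with hδ
  intro φ ψ hφ hψ hφ0 hψ0 hFφ hFψ
  have hδ1 : δ ≤ 1 := min_le_left _ _
  have hδη : δ ≤ η := (min_le_right _ _).trans (min_le_left _ _)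
  have hδK : K * q * δ ≤ η / 2 := by
    have h1 : δ ≤ η / (2 * (K * q + 1)) := (min_le_right _ _).trans (min_le_right _ _)
    have h2 : K * q * δ ≤ (K * q + 1) * (η / (2 * (K * q + 1))) := by gcongr; linarith
    have h3 : (K * q + 1) * (η / (2 * (K * q + 1))) = η / 2 := by field_simp
    linarith
  have bound : ∀ χ, IsTestFunction Ω χ → freeEnergy s q Ω χ ≤ m + δ →
      (powerIntegral q Ω χ).toReal ≤ B := by
    intro χ hχ hF
    have h1 := hcoer χ hχ
    unfold freeEnergy at hF
    have h2 : 1 / q * (powerIntegral q Ω χ).toReal ≤ 1 + 2 * C := by linarith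
    rwa [one_div, inv_mul_le_iff₀ hq] at h2
  have hPφ := bound φ hφ hFφ
  have hPψ := bound ψ hψ hFψ
  have iφ := (hφ.integrable_abs_rpow hq).restrict (s := Ω)
  have iψ := (hψ.integrable_abs_rpow hq).restrict (s := Ω)
  have ia : Integrable (fun x => |φ x| ^ q + |ψ x| ^ q) (volume.restrict Ω) := iφ.add iψ
  have ia2 : Integrable (fun x => (|φ x| ^ q + |ψ x| ^ q) / 2) (volume.restrict Ω) :=
    ia.div_const 2
  have id : Integrable (fun x => |(|φ x| ^ q - |ψ x| ^ q)|) (volume.restrict Ω) :=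
    (iφ.sub iψ).abs
  -- The competitor is √((φ² + ψ²)/2): its energy is at most the mean of the two energies, so
  -- minimality bounds the integrated midpoint gap by q δ.
  set c : ℝ := √(1 / 2) with hc
  have hc2 : c ^ 2 = 1 / 2 := Real.sq_sqrt (by norm_num)
  have iI := ((hφ.const_mul c).integrable_rpow (hψ.const_mul c) hq).restrict (s := Ω)
  have hH := add_lintegral_le_of_forall_le_freeEnergy hN hs0 hs1 hq hm (hφ.const_mul c)
    (hψ.const_mul c)
  rw [(hφ.const_mul c).toReal_lintegral (hψ.const_mul c), gagliardo_const_mul, gagliardo_const_mul,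
    ENNReal.toReal_mul, ENNReal.toReal_mul, hc2, ENNReal.toReal_ofReal (by norm_num)] at hH
  set I := ∫ x in Ω, ((c * φ x) ^ 2 + (c * ψ x) ^ 2) ^ (q / 2) with hI
  have ig : Integrable (fun x => ((c * φ x) ^ 2 + (c * ψ x) ^ 2) ^ (q / 2) -
      (|φ x| ^ q + |ψ x| ^ q) / 2) (volume.restrict Ω) := iI.sub ia2
  have hD : ∫ x in Ω, |(|φ x| ^ q - |ψ x| ^ q)| ≤
      ε * ((powerIntegral q Ω φ).toReal + (powerIntegral q Ω ψ).toReal) +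
        K * (I - ((powerIntegral q Ω φ).toReal + (powerIntegral q Ω ψ).toReal) / 2) := by
    rw [hφ.toReal_powerIntegral, hψ.toReal_powerIntegral, ← integral_add iφ iψ, ← integral_div,
      ← integral_sub iI ia2, ← integral_const_mul, ← integral_const_mul,
      ← integral_add (ia.const_mul ε) (ig.const_mul K)]
    refine integral_mono id ((ia.const_mul ε).add
      (ig.const_mul K)) fun x => ?_
    have := hgap (φ x ^ 2) (ψ x ^ 2) (by positivity) (by positivity)
    simp only [abs_rpow_eq]
    rwa [mul_pow, mul_pow, hc2, ← mul_add, one_div_mul_eq_div]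
  have hDη : ∫ x in Ω, |(|φ x| ^ q - |ψ x| ^ q)| ≤ η := by
    have h1 : ε * ((powerIntegral q Ω φ).toReal + (powerIntegral q Ω ψ).toReal) ≤ ε * (2 * B) := by
      gcongr
      linarith
    have h2 : ε * (2 * B) = η / 2 := by rw [hε]; field_simp; ring
    have h3 : I - ((powerIntegral q Ω φ).toReal + (powerIntegral q Ω ψ).toReal) / 2 ≤ q * δ := by
      unfold freeEnergy at hFφ hFψ
      have h4 : 1 / q * (I - ((powerIntegral q Ω φ).toReal + (powerIntegral q Ω ψ).toReal) / 2)
          ≤ δ := by linarith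
      rwa [one_div, inv_mul_le_iff₀ hq] at h4
    have h5 := mul_le_mul_of_nonneg_left h3 hK
    rw [← mul_assoc] at h5
    linarith
  refine ⟨hDη, (gagliardo_sub_le_of_le_freeEnergy hN hs0 hs1 hq hm hφ hψ hφ0 hψ0).trans ?_⟩
  gcongr
  linarith

end AlmostMinimizers

/-! ### The completion and the existence of the minimiser -/

section Completion

variable {N : ℕ} {s q : ℝ} {Ω : Set (EuclideanSpace ℝ (Fin N))}
  {φ ψ w : EuclideanSpace ℝ (Fin N) → ℝ}

lemma IsTestFunction.memD0 (hφ : IsTestFunction Ω φ) : MemD0 s Ω φ := by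
  refine ⟨fun _ => φ, fun _ => hφ, ?_, Eventually.of_forall fun x => tendsto_const_nhds⟩
  have : gagliardo s (0 : EuclideanSpace ℝ (Fin N) → ℝ) = 0 := gagliardo_zero
  simp [this]

lemma MemD0.aemeasurable (hw : MemD0 s Ω w) : AEMeasurable w := by
  obtain ⟨φ, hφ, -, hae⟩ := hw
  exact aemeasurable_of_tendsto_metrizable_ae atTop (fun n => (hφ n).measurable.aemeasurable) hae

lemma MemD0.gagliardo_ne_top (hw : MemD0 s Ω w) (hN : 1 ≤ N) (hs0 : 0 < s) (hs1 : s < 1) :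
    gagliardo s w ≠ ⊤ := by
  have hwm := hw.aemeasurable
  obtain ⟨φ, hφ, hY, -⟩ := hw
  obtain ⟨n, hn⟩ := (hY.eventually (gt_mem_nhds one_pos)).exists
  have h := gagliardo_le_weighted (s := s) one_pos (hφ n).measurable.aemeasurable hwm
  rw [gagliardo_sub_comm] at h
  refine ne_top_of_le_ne_top (ENNReal.add_ne_top.2 ⟨?_, ?_⟩) h
  · exact ENNReal.mul_ne_top ENNReal.ofReal_ne_top ((hφ n).gagliardo_ne_top hN hs0 hs1)
  · exact ENNReal.mul_ne_top ENNReal.ofReal_ne_top (hn.trans ENNReal.one_lt_top).ne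

/-- Hidden convexity for elements of the completion. -/
lemma MemD0.add_lintegral_le (hN : 1 ≤ N) (hs0 : 0 < s) (hs1 : s < 1) (hq : 0 < q)
    {m : ℝ} (hm : ∀ g, IsTestFunction Ω g → (∀ x, 0 ≤ g x) → m ≤ freeEnergy s q Ω g)
    (hw : MemD0 s Ω w) (hψ : IsTestFunction Ω ψ) :
    ∫⁻ x in Ω, ENNReal.ofReal ((w x ^ 2 + ψ x ^ 2) ^ (q / 2)) ≠ ⊤ ∧
    m + 1 / q * (∫⁻ x in Ω, ENNReal.ofReal ((w x ^ 2 + ψ x ^ 2) ^ (q / 2))).toReal ≤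
      1 / 2 * ((gagliardo s w).toReal + (gagliardo s ψ).toReal) := by
  have hwm := hw.aemeasurable
  have hwY := hw.gagliardo_ne_top hN hs0 hs1
  obtain ⟨φ, hφ, hY, hae⟩ := hw
  have hm0 : m ≤ 0 := by
    simpa [freeEnergy_zero hq] using hm _ IsTestFunction.zero fun x => le_rfl
  set I := ∫⁻ x in Ω, ENNReal.ofReal ((w x ^ 2 + ψ x ^ 2) ^ (q / 2)) with hI
  -- The slack η absorbs the energy excess of the approximating test functions. Bounding I in [0, ∞]
  -- also proves it finite, which `toReal` needs.
  have key : ∀ η : ℝ, 0 < η → I ≤ ENNReal.ofReal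
      (q * (1 / 2 * ((gagliardo s w).toReal + η + (gagliardo s ψ).toReal) - m)) := by
    intro η hη
    have hfatou : I ≤ liminf (fun n =>
        ∫⁻ x in Ω, ENNReal.ofReal ((φ n x ^ 2 + ψ x ^ 2) ^ (q / 2))) atTop := by
      refine le_trans (lintegral_mono_ae ?_) (lintegral_liminf_le fun n => ?_)
      · filter_upwards [ae_restrict_of_ae hae] with x hx
        refine (ENNReal.tendsto_ofReal ?_).liminf_eq.ge
        exact ((hx.pow 2).add_const _).rpow_const (Or.inr (by positivity))
      · have := (hφ n).measurable
        have := hψ.measurable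
        fun_prop
    refine hfatou.trans (liminf_le_of_frequently_le' (Eventually.frequently ?_))
    filter_upwards [eventually_gagliardo_le_add hwm (fun n => (hφ n).measurable.aemeasurable) hwY hY
      (ENNReal.ofReal_pos.2 hη)] with n hn
    have h1 := add_lintegral_le_of_forall_le_freeEnergy hN hs0 hs1 hq hm (hφ n) hψ
    have h2 : (gagliardo s (φ n)).toReal ≤ (gagliardo s w).toReal + η := by
      have := ENNReal.toReal_mono (ENNReal.add_ne_top.2 ⟨hwY, ENNReal.ofReal_ne_top⟩) hn
      rwa [ENNReal.toReal_add hwY ENNReal.ofReal_ne_top, ENNReal.toReal_ofReal hη.le] at this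
    refine ENNReal.le_ofReal_iff_toReal_le
      (((hφ n).integrable_rpow hψ hq).restrict.lintegral_lt_top).ne ?_ |>.2 ?_
    · refine mul_nonneg hq.le ?_
      have : 0 ≤ (gagliardo s w).toReal + η + (gagliardo s ψ).toReal := by positivity
      linarith
    · rw [← inv_mul_le_iff₀ hq, ← one_div]
      linarith
  have hfin : I ≠ ⊤ := ne_top_of_le_ne_top ENNReal.ofReal_ne_top (key 1 one_pos)
  refine ⟨hfin, le_of_forall_pos_le_add fun η hη => ?_⟩
  have h1 := key η hη
  have hnn : 0 ≤ (gagliardo s w).toReal + η + (gagliardo s ψ).toReal := by positivity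
  rw [ENNReal.le_ofReal_iff_toReal_le hfin (mul_nonneg hq.le (by linarith)),
    ← inv_mul_le_iff₀ hq, ← one_div] at h1
  linarith

lemma powerIntegral_eq_lintegral (q : ℝ) (u : EuclideanSpace ℝ (Fin N) → ℝ) :
    powerIntegral q Ω u =
      ∫⁻ x in Ω, ENNReal.ofReal ((u x ^ 2 + (fun _ => (0 : ℝ)) x ^ 2) ^ (q / 2)) := by
  simp [powerIntegral, abs_rpow_eq]

/-- Replacing w by |w| = √(w² + 0²) does not raise the energy, so a lower bound on non-negative test
functions passes to the whole completion. -/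
lemma MemD0.le_freeEnergy (hN : 1 ≤ N) (hs0 : 0 < s) (hs1 : s < 1) (hq : 0 < q)
    {m : ℝ} (hm : ∀ g, IsTestFunction Ω g → (∀ x, 0 ≤ g x) → m ≤ freeEnergy s q Ω g)
    (hw : MemD0 s Ω w) : powerIntegral q Ω w ≠ ⊤ ∧ m ≤ freeEnergy s q Ω w := by
  have h := hw.add_lintegral_le hN hs0 hs1 hq hm (IsTestFunction.zero (Ω := Ω))
  rw [← powerIntegral_eq_lintegral, gagliardo_zero, ENNReal.toReal_zero, add_zero] at h
  refine ⟨h.1, ?_⟩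
  unfold freeEnergy
  linarith [h.2]

/-! ### Existence of the minimiser -/

lemma exists_isGLB_freeEnergy (hN : 1 ≤ N) (hs0 : 0 < s) (hs1 : s < 1) (hq : 0 < q) (hq2 : q < 2)
    (hl : 0 < lambda1 s q Ω) :
    ∃ m : ℝ, (∀ g, IsTestFunction Ω g → (∀ x, 0 ≤ g x) → m ≤ freeEnergy s q Ω g) ∧
      ∀ ε > 0, ∃ g, IsTestFunction Ω g ∧ (∀ x, 0 ≤ g x) ∧ freeEnergy s q Ω g < m + ε := by
  obtain ⟨C, -, hcoer⟩ := exists_powerIntegral_le hN hs0 hs1 hq hq2 hl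
  set S : Set ℝ := freeEnergy s q Ω '' {g | IsTestFunction Ω g ∧ ∀ x, 0 ≤ g x} with hS
  have hbdd : BddBelow S := by
    refine ⟨-C, ?_⟩
    rintro _ ⟨g, ⟨hg, -⟩, rfl⟩
    have := hcoer g hg
    have h0 : 0 ≤ (gagliardo s g).toReal := ENNReal.toReal_nonneg
    unfold freeEnergy
    linarith
  have hne : S.Nonempty := ⟨_, fun _ => 0, ⟨IsTestFunction.zero, fun _ => le_rfl⟩, rfl⟩
  refine ⟨sInf S, fun g hg hg0 => csInf_le hbdd ⟨g, ⟨hg, hg0⟩, rfl⟩, fun ε hε => ?_⟩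
  obtain ⟨_, ⟨g, ⟨hg, hg0⟩, rfl⟩, hlt⟩ := exists_lt_of_csInf_lt hne (lt_add_of_pos_right _ hε)
  exact ⟨g, hg, hg0, hlt⟩

/-- There is a minimising sequence whose `q`-th powers converge geometrically in `L¹` and which
is a Cauchy sequence in the Gagliardo seminorm. -/
lemma exists_minimizing_sequence (hN : 1 ≤ N) (hs0 : 0 < s) (hs1 : s < 1) (hq : 0 < q)
    (hq2 : q < 2) (hl : 0 < lambda1 s q Ω) :
    ∃ (m : ℝ) (f : ℕ → EuclideanSpace ℝ (Fin N) → ℝ),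
      (∀ g, IsTestFunction Ω g → (∀ x, 0 ≤ g x) → m ≤ freeEnergy s q Ω g) ∧
      (∀ n, IsTestFunction Ω (f n)) ∧ (∀ n x, 0 ≤ f n x) ∧
      ∀ k n, k ≤ n → freeEnergy s q Ω (f n) ≤ m + (1 / 2) ^ (k + 1) ∧
        ∀ j, k ≤ j → ∫ x in Ω, |(|f n x| ^ q - |f j x| ^ q)| ≤ (1 / 2) ^ (k + 1) ∧
          (gagliardo s (fun x => f n x - f j x)).toReal ≤
            8 * (1 / 2) ^ (k + 1) + 4 / q * (1 / 2) ^ (k + 1) := by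
  obtain ⟨m, hm, hex⟩ := exists_isGLB_freeEnergy hN hs0 hs1 hq hq2 hl
  choose δ hδ hmod using fun k : ℕ => exists_modulus_of_le_freeEnergy hN hs0 hs1 hq hq2 hl hm
    (η := (1 / 2) ^ (k + 1)) (by positivity)
  choose g hg hg0 hgF using fun n : ℕ => hex (1 / ((n : ℝ) + 1)) (by positivity)
  -- The threshold takes care of both demands: δ k gives closeness at scale k, and (1/2)^(k + 1)
  -- makes the energies tend to m.
  have hev : ∀ k, ∀ᶠ n in atTop, ∀ j ≥ n,
      freeEnergy s q Ω (g j) ≤ m + min (δ k) ((1 / 2) ^ (k + 1)) := by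
    intro k
    refine eventually_forall_ge_atTop.2 ?_
    have : 0 < min (δ k) ((1 / 2) ^ (k + 1)) := lt_min (hδ k) (by positivity)
    filter_upwards [tendsto_one_div_add_atTop_nhds_zero_nat.eventually (gt_mem_nhds this)]
      with n hn
    linarith [hgF n]
  obtain ⟨τ, hτ, hτF⟩ := extraction_forall_of_eventually hev
  have hF : ∀ k n, k ≤ n →
      freeEnergy s q Ω (g (τ n)) ≤ m + min (δ k) ((1 / 2) ^ (k + 1)) :=
    fun k n hkn => hτF k (τ n) (hτ.monotone hkn)
  refine ⟨m, fun n => g (τ n), hm, fun n => hg _, fun n => hg0 _, fun k n hkn => ⟨?_, ?_⟩⟩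
  · exact (hF k n hkn).trans (by gcongr; exact min_le_right _ _)
  · intro j hkj
    exact hmod k _ _ (hg _) (hg _) (hg0 _) (hg0 _)
      ((hF k n hkn).trans (by gcongr; exact min_le_left _ _))
      ((hF k j hkj).trans (by gcongr; exact min_le_left _ _))

/-- A geometric L¹ Cauchy rate for the q-th powers gives their almost everywhere convergence;
non-negativity allows taking q-th roots. -/
lemma exists_ae_tendsto_of_lintegral_cauchy (hq : 0 < q)
    {f : ℕ → EuclideanSpace ℝ (Fin N) → ℝ} (hf : ∀ n, IsTestFunction Ω (f n))
    (hf0 : ∀ n x, 0 ≤ f n x)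
    (hc : ∀ k n j, k ≤ n → k ≤ j →
      ∫ x in Ω, |(|f n x| ^ q - |f j x| ^ q)| ≤ (1 / 2) ^ (k + 1)) :
    ∃ w : EuclideanSpace ℝ (Fin N) → ℝ, Measurable w ∧
      ∀ᵐ x, Tendsto (fun n => f n x) atTop (𝓝 (w x)) := by
  have hB : ∑' k : ℕ, ENNReal.ofReal ((1 / 2) ^ k) ≠ ⊤ := by
    rw [← ENNReal.ofReal_tsum_of_nonneg (fun k => by positivity) summable_geometric_two]
    exact ENNReal.ofReal_ne_top
  have h := Lp.ae_tendsto_of_cauchy_eLpNorm (μ := volume) (p := 1)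
    (f := fun n x => |f n x| ^ q) (fun n => ((hf n).integrable_abs_rpow hq).aestronglyMeasurable)
    le_rfl hB ?_
  · refine (measurable_limit_of_tendsto_metrizable_ae
      (fun n => (hf n).measurable.aemeasurable) ?_)
    filter_upwards [h] with x ⟨l, hl⟩
    refine ⟨l ^ q⁻¹, ?_⟩
    have := hl.rpow_const (p := q⁻¹) (Or.inr (by positivity))
    refine this.congr fun n => ?_
    rw [← Real.rpow_mul (abs_nonneg _), mul_inv_cancel₀ hq.ne', Real.rpow_one,
      abs_of_nonneg (hf0 n x)]
  · intro k n j hn hj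
    rw [eLpNorm_one_eq_lintegral_enorm, ← ofReal_integral_norm_eq_lintegral_enorm
      (((hf n).integrable_abs_rpow hq).sub ((hf j).integrable_abs_rpow hq))]
    refine (ENNReal.ofReal_lt_ofReal_iff (by positivity)).2 ?_
    have h1 : ∫ x in Ω, |(|f n x| ^ q - |f j x| ^ q)| = ∫ x, |(|f n x| ^ q - |f j x| ^ q)| := by
      refine setIntegral_eq_integral_of_forall_compl_eq_zero fun x hx => ?_
      simp [(hf n).eq_zero hx, (hf j).eq_zero hx]
    have h2 := hc k n j hn hj
    rw [h1] at h2
    -- The exponent k + 1 in the hypothesis supplies the strict inequality with (1/2)^k that the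
    -- convergence criterion requires.
    refine h2.trans_lt ?_
    rw [pow_succ]
    have : (0 : ℝ) < (1 / 2) ^ k := by positivity
    linarith

theorem exists_isLeastEnergy (hN : 1 ≤ N) (hs0 : 0 < s) (hs1 : s < 1) (hq : 0 < q)
    (hq2 : q < 2) (hl : 0 < lambda1 s q Ω) : ∃ w, IsLeastEnergy s q Ω w := by
  obtain ⟨m, f, hm, hf, hf0, hcau⟩ := exists_minimizing_sequence hN hs0 hs1 hq hq2 hl
  obtain ⟨w, hwm, hae⟩ := exists_ae_tendsto_of_lintegral_cauchy hq hf hf0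
    fun k n j hn hj => ((hcau k n hn).2 j hj).1
  have hpow0 : Tendsto (fun k : ℕ => (1 / 2 : ℝ) ^ (k + 1)) atTop (𝓝 0) :=
    (tendsto_pow_atTop_nhds_zero_of_lt_one (by norm_num) (by norm_num)).comp (tendsto_add_atTop_nat 1)
  have hYsub : ∀ n j, gagliardo s (fun x => f n x - f j x) ≠ ⊤ := fun n j => by
    simpa [sub_eq_add_neg] using ((hf n).add ((hf j).const_mul (-1))).gagliardo_ne_top hN hs0 hs1
  have hY : ∀ k, gagliardo s (w - f k) ≤
      ENNReal.ofReal (8 * (1 / 2) ^ (k + 1) + 4 / q * (1 / 2) ^ (k + 1)) := by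
    intro k
    refine gagliardo_le_of_tendsto (f := fun n x => f n x - f k x)
      (fun n => (hf n).measurable.sub (hf k).measurable) ?_ ?_
    · filter_upwards [hae] with x hx
      exact hx.sub_const _
    · filter_upwards [eventually_ge_atTop k] with n hn
      exact (ENNReal.le_ofReal_iff_toReal_le (hYsub n k) (by positivity)).2
        ((hcau k n hn).2 k le_rfl).2
  have hmem : MemD0 s Ω w := by
    refine ⟨f, hf, ?_, hae⟩
    have hlim : Tendsto (fun k : ℕ => ENNReal.ofReal
        (8 * (1 / 2) ^ (k + 1) + 4 / q * (1 / 2) ^ (k + 1))) atTop (𝓝 0) := by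
      simpa using ENNReal.tendsto_ofReal ((hpow0.const_mul 8).add (hpow0.const_mul (4 / q)))
    exact tendsto_of_tendsto_of_tendsto_of_le_of_le tendsto_const_nhds hlim (fun _ => zero_le) hY
  have hw0 : ∀ᵐ x, 0 ≤ w x := by
    filter_upwards [hae] with x hx
    exact ge_of_tendsto' hx fun n => hf0 n x
  obtain ⟨hPfin, -⟩ := hmem.le_freeEnergy hN hs0 hs1 hq hm
  -- Fatou in the second index turns the Cauchy bound into one for |f n|^q - |w|^q. The power
  -- integral enters F with a minus sign, so Fatou applied to it directly would go the wrong way.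
  have hPn : ∀ n, (powerIntegral q Ω (f n)).toReal ≤
      (powerIntegral q Ω w).toReal + (1 / 2) ^ (n + 1) := by
    intro n
    have hdiff : ∫⁻ x in Ω, ENNReal.ofReal |(|f n x| ^ q - |w x| ^ q)| ≤
        ENNReal.ofReal ((1 / 2) ^ (n + 1)) := by
      have hfatou : ∫⁻ x in Ω, ENNReal.ofReal |(|f n x| ^ q - |w x| ^ q)| ≤
          liminf (fun j => ∫⁻ x in Ω, ENNReal.ofReal |(|f n x| ^ q - |f j x| ^ q)|) atTop := by
        refine le_trans (lintegral_mono_ae ?_) (lintegral_liminf_le fun j => ?_)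
        · filter_upwards [ae_restrict_of_ae hae] with x hx
          refine (ENNReal.tendsto_ofReal ?_).liminf_eq.ge
          exact ((hx.abs.rpow_const (Or.inr hq.le)).const_sub _).abs
        · have := (hf n).measurable
          have := (hf j).measurable
          fun_prop
      refine hfatou.trans (liminf_le_of_frequently_le' (Eventually.frequently ?_))
      filter_upwards [eventually_ge_atTop n] with j hj
      have hInt : Integrable (fun x => |(|f n x| ^ q - |f j x| ^ q)|) (volume.restrict Ω) :=
        (((hf n).integrable_abs_rpow hq).sub ((hf j).integrable_abs_rpow hq)).abs.restrict
      rw [← ofReal_integral_eq_lintegral_ofReal hInt (Eventually.of_forall fun x => abs_nonneg _)]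
      exact ENNReal.ofReal_le_ofReal ((hcau n n le_rfl).2 j hj).1
    have hle : powerIntegral q Ω (f n) ≤ powerIntegral q Ω w + ENNReal.ofReal ((1 / 2) ^ (n + 1)) := by
      refine le_trans ?_ (add_le_add le_rfl hdiff)
      unfold powerIntegral
      rw [← lintegral_add_left (by fun_prop)]
      refine lintegral_mono fun x => ?_
      rw [← ENNReal.ofReal_add (by positivity) (abs_nonneg _)]
      refine ENNReal.ofReal_le_ofReal ?_
      linarith [le_abs_self (|f n x| ^ q - |w x| ^ q)]
    have := ENNReal.toReal_mono (ENNReal.add_ne_top.2 ⟨hPfin, ENNReal.ofReal_ne_top⟩) hle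
    rwa [ENNReal.toReal_add hPfin ENNReal.ofReal_ne_top, ENNReal.toReal_ofReal (by positivity)]
      at this
  have hYw : ∀ k : ℕ, (gagliardo s w).toReal ≤ 2 * (m + (1 / 2) ^ (k + 1) +
      1 / q * ((powerIntegral q Ω w).toReal + (1 / 2) ^ (k + 1))) := by
    intro k
    have hreal : ∀ n, k ≤ n → (gagliardo s (f n)).toReal ≤ 2 * (m + (1 / 2) ^ (k + 1) +
        1 / q * ((powerIntegral q Ω w).toReal + (1 / 2) ^ (k + 1))) := by
      intro n hn
      have h1 := (hcau k n hn).1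
      have h2 := mul_le_mul_of_nonneg_left (hPn n) (one_div_pos.2 hq).le
      have h3 : (1 / 2 : ℝ) ^ (n + 1) ≤ (1 / 2) ^ (k + 1) :=
        pow_le_pow_of_le_one (by norm_num) (by norm_num) (by omega)
      have h4 := mul_le_mul_of_nonneg_left h3 (one_div_pos.2 hq).le
      unfold freeEnergy at h1
      linarith
    refine ENNReal.toReal_le_of_le_ofReal (ENNReal.toReal_nonneg.trans (hreal k le_rfl)) ?_
    refine gagliardo_le_of_tendsto (fun n => (hf n).measurable) hae ?_
    filter_upwards [eventually_ge_atTop k] with n hn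
    rw [← ENNReal.ofReal_toReal ((hf n).gagliardo_ne_top hN hs0 hs1)]
    exact ENNReal.ofReal_le_ofReal (hreal n hn)
  have hFw : freeEnergy s q Ω w ≤ m := by
    have hlim : Tendsto (fun k : ℕ => 2 * (m + (1 / 2) ^ (k + 1) +
        1 / q * ((powerIntegral q Ω w).toReal + (1 / 2) ^ (k + 1)))) atTop
        (𝓝 (2 * (m + 0 + 1 / q * ((powerIntegral q Ω w).toReal + 0)))) :=
      ((hpow0.const_add m).add ((hpow0.const_add _).const_mul _)).const_mul 2
    have := ge_of_tendsto' hlim hYw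
    unfold freeEnergy
    linarith
  exact ⟨w, hmem, ae_restrict_of_ae hw0,
    fun φ hφ _ => hFw.trans (hφ.le_freeEnergy hN hs0 hs1 hq hm).2⟩

end Completion

/-! ### The inequality for a minimiser, and λ₁ > 0 on bounded sets -/

section Inequality

variable {N : ℕ} {s q : ℝ} {Ω : Set (EuclideanSpace ℝ (Fin N))}
  {u w : EuclideanSpace ℝ (Fin N) → ℝ}

/-! ### The Lane–Emden inequality when the minimiser exists -/

/-- Concavity with the tangent taken at the right end a + h, in the form of Bernoulli's inequality.
This end keeps the denominator away from 0 when a = 0 < h. -/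
lemma rpow_add_tangent_le {p a h : ℝ} (hp0 : 0 ≤ p) (hp1 : p ≤ 1) (ha : 0 ≤ a) (hh : 0 ≤ h) :
    p * (h / (a + h) ^ (1 - p)) + a ^ p ≤ (a + h) ^ p := by
  rcases (add_nonneg ha hh).eq_or_lt with h0 | hX
  · have ha0 : a = 0 := by linarith
    have hh0 : h = 0 := by linarith
    simp [ha0, hh0]
  set X := a + h with hXdef
  have hle : (1 + -(h / X)) ^ p ≤ 1 + p * -(h / X) := by
    refine rpow_one_add_le_one_add_mul_self ?_ hp0 hp1
    have : h / X ≤ 1 := (div_le_one hX).2 (by linarith)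
    linarith
  have haX : a = X * (1 + -(h / X)) := by
    field_simp
    rw [hXdef]
    ring
  have h1 : 0 ≤ 1 + -(h / X) := by
    have : h / X ≤ 1 := (div_le_one hX).2 (by linarith)
    linarith
  have hXp : 0 < X ^ p := Real.rpow_pos_of_pos hX p
  have h2 : a ^ p = X ^ p * (1 + -(h / X)) ^ p := by
    conv_lhs => rw [haX]
    exact Real.mul_rpow hX.le h1
  have h3 : h / X ^ (1 - p) = X ^ p * (h / X) := by
    rw [Real.rpow_sub hX, Real.rpow_one]
    field_simp
  rw [h2, h3]
  nlinarith [mul_le_mul_of_nonneg_left hle hXp.le]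

/-- Minimality tested with √(w² + t u²), followed by the tangent inequality; the terms in w cancel
and t/2 divides out. -/
lemma IsLeastEnergy.lintegral_regularized_le (hN : 1 ≤ N) (hs0 : 0 < s) (hs1 : s < 1) (hq : 0 < q)
    (hq2 : q < 2) (hw : IsLeastEnergy s q Ω w) (hu : IsTestFunction Ω u) {t : ℝ} (ht : 0 < t) :
    ∫⁻ x in Ω, ENNReal.ofReal (u x ^ 2 / (w x ^ 2 + t * u x ^ 2) ^ (1 - q / 2)) ≤
      gagliardo s u := by
  have hm : ∀ g, IsTestFunction Ω g → (∀ x, 0 ≤ g x) → freeEnergy s q Ω w ≤ freeEnergy s q Ω g :=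
    fun g hg hg0 => hw.le g hg.memD0 (Eventually.of_forall hg0)
  have hwm := hw.mem.aemeasurable
  have hum := hu.measurable
  obtain ⟨hPfin, -⟩ := hw.mem.le_freeEnergy hN hs0 hs1 hq hm
  obtain ⟨hIfin, hI⟩ := hw.mem.add_lintegral_le hN hs0 hs1 hq hm (hu.const_mul √t)
  simp only [mul_pow, Real.sq_sqrt ht.le] at hIfin hI
  rw [gagliardo_const_mul, ENNReal.toReal_mul, Real.sq_sqrt ht.le, ENNReal.toReal_ofReal ht.le] at hI
  set I := ∫⁻ x in Ω, ENNReal.ofReal ((w x ^ 2 + t * u x ^ 2) ^ (q / 2)) with hIdef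
  set J := ∫⁻ x in Ω, ENNReal.ofReal (u x ^ 2 / (w x ^ 2 + t * u x ^ 2) ^ (1 - q / 2)) with hJdef
  have hpow : AEMeasurable (fun x => ENNReal.ofReal (|w x| ^ q)) (volume.restrict Ω) :=
    ((hwm.restrict.abs).pow_const q).ennreal_ofReal
  have hsum : ENNReal.ofReal (q / 2 * t) * J + powerIntegral q Ω w ≤ I := by
    rw [hJdef, ← lintegral_const_mul' _ _ ENNReal.ofReal_ne_top, powerIntegral,
      ← lintegral_add_right' _ hpow]
    refine lintegral_mono fun x => ?_
    rw [← ENNReal.ofReal_mul (by positivity), ← ENNReal.ofReal_add (by positivity) (by positivity)]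
    refine ENNReal.ofReal_le_ofReal ?_
    have := rpow_add_tangent_le (p := q / 2) (a := w x ^ 2) (h := t * u x ^ 2) (by positivity)
      (by linarith) (by positivity) (by positivity)
    rw [abs_rpow_eq]
    refine le_trans (le_of_eq ?_) this
    ring
  have hJfin : J ≠ ⊤ := by
    intro hJ
    rw [hJ, ENNReal.mul_top (by simpa using mul_pos (half_pos hq) ht), top_add] at hsum
    exact hIfin (top_le_iff.1 hsum)
  have hreal := ENNReal.toReal_mono hIfin hsum
  rw [ENNReal.toReal_add (ENNReal.mul_ne_top ENNReal.ofReal_ne_top hJfin) hPfin,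
    ENNReal.toReal_mul, ENNReal.toReal_ofReal (by positivity)] at hreal
  rw [← ENNReal.toReal_le_toReal hJfin (hu.gagliardo_ne_top hN hs0 hs1)]
  have h1 := mul_le_mul_of_nonneg_left hreal (one_div_pos.2 hq).le
  have h2 : 1 / q * (q / 2 * t * J.toReal + (powerIntegral q Ω w).toReal) =
      t / 2 * J.toReal + 1 / q * (powerIntegral q Ω w).toReal := by
    field_simp
  rw [h2] at h1
  unfold freeEnergy at hI
  have h3 : t / 2 * J.toReal ≤ t / 2 * (gagliardo s u).toReal := by linarith
  exact le_of_mul_le_mul_left h3 (by positivity)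

theorem IsLeastEnergy.lintegral_div_le (hN : 1 ≤ N) (hs0 : 0 < s) (hs1 : s < 1) (hq : 0 < q)
    (hq2 : q < 2) (hw : IsLeastEnergy s q Ω w) (hu : IsTestFunction Ω u) :
    ∫⁻ x in Ω, ENNReal.ofReal (u x ^ 2) / ENNReal.ofReal (w x) ^ (2 - q) ≤ gagliardo s u := by
  set t : ℕ → ℝ := fun n => 1 / ((n : ℝ) + 1)
  have ht : ∀ n, 0 < t n := fun n => by positivity
  have ht0 : Tendsto t atTop (𝓝 0) := tendsto_one_div_add_atTop_nhds_zero_nat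
  have hwm := hw.mem.aemeasurable.restrict (s := Ω)
  have hum := hu.measurable
  have hp : 0 < 1 - q / 2 := by linarith
  have hfatou : ∫⁻ x in Ω, ENNReal.ofReal (u x ^ 2) / ENNReal.ofReal (w x) ^ (2 - q) ≤
      liminf (fun n => ∫⁻ x in Ω,
        ENNReal.ofReal (u x ^ 2 / (w x ^ 2 + t n * u x ^ 2) ^ (1 - q / 2))) atTop := by
    refine le_trans (lintegral_mono_ae ?_) (lintegral_liminf_le' fun n => ?_)
    · filter_upwards [hw.nonneg] with x hx
      -- Where u = 0 the quotient is 0 in [0, ∞], even if w = 0. Elsewhere the numerator is non-zero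
      -- and finite, so division is continuous even where w = 0.
      by_cases hux : u x = 0
      · simp [hux]
      have hu2 : 0 < u x ^ 2 := by positivity
      refine (Tendsto.liminf_eq ?_).ge
      have heq : ∀ n, ENNReal.ofReal (u x ^ 2 / (w x ^ 2 + t n * u x ^ 2) ^ (1 - q / 2)) =
          ENNReal.ofReal (u x ^ 2) / ENNReal.ofReal (w x ^ 2 + t n * u x ^ 2) ^ (1 - q / 2) := by
        intro n
        have hX : 0 < w x ^ 2 + t n * u x ^ 2 := by
          have := mul_pos (ht n) hu2
          positivity
        rw [ENNReal.ofReal_div_of_pos (Real.rpow_pos_of_pos hX _),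
          ENNReal.ofReal_rpow_of_nonneg hX.le hp.le]
      have hlimeq : ENNReal.ofReal (w x) ^ (2 - q) = ENNReal.ofReal (w x ^ 2) ^ (1 - q / 2) := by
        rw [ENNReal.ofReal_pow hx, ← ENNReal.rpow_natCast, ← ENNReal.rpow_mul]
        congr 1
        push_cast
        ring
      simp only [heq]
      rw [hlimeq]
      refine ENNReal.Tendsto.div tendsto_const_nhds (Or.inl (by simpa using hux)) ?_
        (Or.inr ENNReal.ofReal_ne_top)
      refine Tendsto.ennrpow_const _ (ENNReal.tendsto_ofReal ?_)
      simpa using (ht0.mul_const (u x ^ 2)).const_add (w x ^ 2)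
    · refine AEMeasurable.ennreal_ofReal ?_
      exact AEMeasurable.div (by fun_prop)
        (((hwm.pow_const 2).add (by fun_prop)).pow_const _)
  exact hfatou.trans (liminf_le_of_frequently_le' (Frequently.of_forall fun n =>
    hw.lintegral_regularized_le hN hs0 hs1 hq hq2 hu (ht n)))

lemma isLeastEnergy_leastEnergy (hN : 1 ≤ N) (hs0 : 0 < s) (hs1 : s < 1) (hq : 0 < q)
    (hq2 : q < 2) (hl : 0 < lambda1 s q Ω) : IsLeastEnergy s q Ω (leastEnergy s q Ω) := by
  have h := exists_isLeastEnergy hN hs0 hs1 hq hq2 hl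
  rw [leastEnergy, dif_pos h]
  exact h.choose_spec

/-! ### Bounded sets -/

lemma rpow_le_rpow_add_mul_sq {a t : ℝ} (ha : 0 < a) (ht : 0 ≤ t) (hq : 0 ≤ q) (hq2 : q ≤ 2) :
    t ^ q ≤ a ^ q + a ^ (q - 2) * t ^ 2 := by
  rcases le_total t a with h | h
  · have := Real.rpow_le_rpow ht h hq
    have : 0 ≤ a ^ (q - 2) * t ^ 2 := by positivity
    linarith
  · have ht0 : 0 < t := ha.trans_le h
    have h1 : t ^ (q - 2) ≤ a ^ (q - 2) := Real.rpow_le_rpow_of_nonpos ha h (by linarith)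
    have h2 : t ^ q = t ^ (q - 2) * t ^ 2 := by
      rw [← Real.rpow_natCast t 2, ← Real.rpow_add ht0]
      congr 1
      push_cast
      ring
    rw [h2]
    have : 0 ≤ a ^ q := by positivity
    nlinarith [mul_le_mul_of_nonneg_right h1 (sq_nonneg t)]

/-- The fractional Poincaré inequality on bounded sets. -/
lemma exists_mul_lintegral_sq_le_gagliardo (hN : 1 ≤ N) (hs0 : 0 < s) {R : ℝ} (hR : 0 ≤ R)
    (hΩ : Ω ⊆ Metric.ball 0 R) :
    ∃ c : ℝ≥0∞, 0 < c ∧ ∀ φ, IsTestFunction Ω φ →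
      c * ∫⁻ x in Ω, ENNReal.ofReal (φ x ^ 2) ≤ gagliardo s φ := by
  -- The unit ball about z misses Ω, so φ vanishes on it, and its points lie within ρ = 2R + 2 of Ω.
  -- Restricting y to this ball bounds the inner integral below by a multiple of φ(x)².
  set z : EuclideanSpace ℝ (Fin N) := EuclideanSpace.single ⟨0, hN⟩ (R + 1)
  have hz : ‖z‖ = R + 1 := by
    rw [PiLp.norm_single, Real.norm_of_nonneg (by linarith)]
  set α : ℝ := (N : ℝ) + 2 * s
  have hα : 0 < α := by positivity
  set ρ : ℝ := 2 * R + 2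
  have hρ : 0 < ρ := by positivity
  have hvol : 0 < volume (Metric.ball z 1) := Metric.measure_ball_pos _ _ one_pos
  refine ⟨ENNReal.ofReal (ρ ^ α)⁻¹ * volume (Metric.ball z 1), ?_, fun φ hφ => ?_⟩
  · exact ENNReal.mul_pos (by simpa using Real.rpow_pos_of_pos hρ α) hvol.ne'
  have hsq : Measurable fun x => ENNReal.ofReal (φ x ^ 2) := by
    have := hφ.measurable
    fun_prop
  refine le_trans (mul_le_mul_right (setLIntegral_le_lintegral Ω _) _) ?_
  rw [← lintegral_const_mul _ hsq]
  refine lintegral_mono fun x => ?_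
  by_cases hx : x ∈ Ω
  swap
  · simp [hφ.eq_zero hx]
  have hxR : ‖x‖ < R := by simpa using hΩ hx
  calc ENNReal.ofReal (ρ ^ α)⁻¹ * volume (Metric.ball z 1) * ENNReal.ofReal (φ x ^ 2)
      = ∫⁻ _ in Metric.ball z 1, ENNReal.ofReal (φ x ^ 2 / ρ ^ α) := by
        rw [setLIntegral_const, div_eq_mul_inv, ENNReal.ofReal_mul (sq_nonneg _)]
        ring
    _ ≤ ∫⁻ y in Metric.ball z 1, ENNReal.ofReal ((φ x - φ y) ^ 2 / ‖x - y‖ ^ α) := by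
        refine setLIntegral_mono' measurableSet_ball fun y hy => ?_
        have hyz : ‖y - z‖ < 1 := by simpa [dist_eq_norm] using hy
        have hy1 : R < ‖y‖ := by
          have := norm_sub_norm_le z y
          rw [norm_sub_rev, hz] at this
          linarith
        have hy2 : ‖y‖ < R + 2 := by
          have := norm_sub_norm_le y z
          rw [hz] at this
          linarith
        have hyΩ : y ∉ Ω := fun h => by
          have : ‖y‖ < R := by simpa using hΩ h
          linarith
        have hxy0 : 0 < ‖x - y‖ := by
          have := norm_sub_norm_le y x
          rw [norm_sub_rev] at this
          linarith
        have hxy : ‖x - y‖ ≤ ρ := by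
          have := norm_sub_le x y
          linarith
        rw [hφ.eq_zero hyΩ, sub_zero]
        exact ENNReal.ofReal_le_ofReal (div_le_div_of_nonneg_left (sq_nonneg _)
          (Real.rpow_pos_of_pos hxy0 α) (Real.rpow_le_rpow hxy0.le hxy hα.le))
    _ ≤ _ := setLIntegral_le_lintegral _ _

/-- On a set of finite measure t^q ≤ a^q + a^(q-2) t² bounds the power integral by the L² one. With
a^q |Ω| ≤ 1/2, the normalisation forces a^(q-2) ∫ φ² ≥ 1/2, and Poincaré concludes. -/
lemma lambda1_pos_of_subset_ball (hN : 1 ≤ N) (hs0 : 0 < s) (hq : 0 < q) (hq2 : q < 2)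
    {R : ℝ} (hR : 0 ≤ R) (hΩ : Ω ⊆ Metric.ball 0 R) : 0 < lambda1 s q Ω := by
  obtain ⟨c, hc, hpoinc⟩ := exists_mul_lintegral_sq_le_gagliardo (s := s) hN hs0 hR hΩ
  have hVfin : volume Ω ≠ ⊤ := ((measure_mono hΩ).trans_lt measure_ball_lt_top).ne
  set V := (volume Ω).toReal with hV
  have hV0 : 0 ≤ V := ENNReal.toReal_nonneg
  set a : ℝ := (1 / (2 * (V + 1))) ^ q⁻¹
  have ha : 0 < a := by positivity
  have haq : a ^ q = 1 / (2 * (V + 1)) := by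
    rw [← Real.rpow_mul (by positivity), inv_mul_cancel₀ hq.ne', Real.rpow_one]
  have haV : ENNReal.ofReal (a ^ q) * volume Ω ≤ 2⁻¹ := by
    rw [← ENNReal.ofReal_toReal hVfin, ← ENNReal.ofReal_mul (by positivity), haq,
      show (2⁻¹ : ℝ≥0∞) = ENNReal.ofReal (1 / 2) by simp]
    refine ENNReal.ofReal_le_ofReal ?_
    rw [← hV, one_div_mul_eq_div, div_le_div_iff₀ (by positivity) (by norm_num)]
    linarith
  set k := ENNReal.ofReal (a ^ (q - 2)) with hk
  have hk0 : k ≠ 0 := by simpa [hk] using Real.rpow_pos_of_pos ha (q - 2)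
  refine lt_of_lt_of_le (b := c * (2⁻¹ / k)) ?_ (le_iInf₂ fun φ hφ => le_iInf fun h1 => ?_)
  · exact ENNReal.mul_pos hc.ne' (ENNReal.div_pos (by simp) ENNReal.ofReal_ne_top).ne'
  refine le_trans (mul_le_mul_right ?_ c) (hpoinc φ hφ)
  set S := ∫⁻ x in Ω, ENNReal.ofReal (φ x ^ 2) with hS
  have hle : 1 ≤ 2⁻¹ + k * S := by
    refine le_trans ?_ (add_le_add_left haV _)
    rw [← h1, hS, ← lintegral_const_mul' _ _ ENNReal.ofReal_ne_top, ← setLIntegral_const,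
      ← lintegral_add_left measurable_const]
    refine lintegral_mono fun x => ?_
    rw [← ENNReal.ofReal_mul (by positivity), ← ENNReal.ofReal_add (by positivity) (by positivity)]
    refine ENNReal.ofReal_le_ofReal ?_
    simpa using rpow_le_rpow_add_mul_sq ha (abs_nonneg (φ x)) hq.le hq2.le
  refine ENNReal.div_le_of_le_mul' ?_
  rw [← ENNReal.one_sub_inv_two]
  exact tsub_le_iff_left.2 hle

end Inequality

/-! ### Exhaustion by balls and the general case -/

section Limit

variable {N : ℕ} {s q : ℝ} {Ω : Set (EuclideanSpace ℝ (Fin N))}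
  {u w : EuclideanSpace ℝ (Fin N) → ℝ}

/-! ### Passage to the limit along balls -/

/-- The map t ↦ c / t^p is antitone and continuous on [0, ∞] for 0 < c < ∞, so it exchanges limsup
and liminf. Hence no monotonicity of the densities in n is needed. -/
lemma div_limsup_rpow {p : ℝ} (hp : 0 ≤ p) {c : ℝ≥0∞} (hc0 : c ≠ 0) (hc : c ≠ ⊤)
    (a : ℕ → ℝ≥0∞) :
    c / limsup a atTop ^ p = liminf (fun n => c / a n ^ p) atTop := by
  have hanti : Antitone fun t : ℝ≥0∞ => c / t ^ p := fun t t' h =>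
    ENNReal.div_le_div_left (ENNReal.rpow_le_rpow h hp) c
  refine hanti.map_limsup_of_continuousAt a (Continuous.continuousAt ?_)
  exact continuous_iff_continuousAt.2 fun t => ENNReal.Tendsto.div tendsto_const_nhds (Or.inl hc0)
    (ENNReal.continuous_rpow_const.tendsto t) (Or.inr hc)

theorem lintegral_div_laneEmdenDensity_le (hN : 1 ≤ N) (hs0 : 0 < s) (hs1 : s < 1) (hq : 0 < q)
    (hq2 : q < 2) (hΩ : IsOpen Ω) (hu : IsTestFunction Ω u) :
    ∫⁻ x in Ω, ENNReal.ofReal (u x ^ 2) / laneEmdenDensity s q Ω x ^ (2 - q) ≤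
      gagliardo s u := by
  by_cases hl : 0 < lambda1 s q Ω
  · simp only [laneEmdenDensity, if_pos hl]
    exact (isLeastEnergy_leastEnergy hN hs0 hs1 hq hq2 hl).lintegral_div_le hN hs0 hs1 hq hq2 hu
  simp only [laneEmdenDensity, if_neg hl]
  set U : ℕ → Set (EuclideanSpace ℝ (Fin N)) := fun n => Ω ∩ Metric.ball 0 (n : ℝ)
  have hw : ∀ n, IsLeastEnergy s q (U n) (leastEnergy s q (U n)) := fun n =>
    isLeastEnergy_leastEnergy hN hs0 hs1 hq hq2
      (lambda1_pos_of_subset_ball hN hs0 hq hq2 n.cast_nonneg Set.inter_subset_right)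
  have hum := hu.measurable
  have hfatou : ∫⁻ x in Ω, ENNReal.ofReal (u x ^ 2) /
      limsup (fun n : ℕ => ENNReal.ofReal (leastEnergy s q (U n) x)) atTop ^ (2 - q) ≤
      liminf (fun n => ∫⁻ x in Ω, ENNReal.ofReal (u x ^ 2) /
        ENNReal.ofReal (leastEnergy s q (U n) x) ^ (2 - q)) atTop := by
    refine le_trans (lintegral_mono fun x => ?_) (lintegral_liminf_le' fun n => ?_)
    · by_cases hux : u x = 0
      · simp [hux]
      · exact (div_limsup_rpow (by linarith) (by simpa using hux) ENNReal.ofReal_ne_top _).le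
    · have hwm := (hw n).mem.aemeasurable.restrict (s := Ω)
      exact AEMeasurable.div (by fun_prop) (hwm.ennreal_ofReal.pow_const _)
  refine hfatou.trans (liminf_le_of_frequently_le' (Eventually.frequently ?_))
  obtain ⟨R, hR⟩ := hu.compact.isCompact.isBounded.subset_ball 0
  filter_upwards [eventually_ge_atTop ⌈R⌉₊] with n hn
  have hball : tsupport u ⊆ Metric.ball 0 (n : ℝ) :=
    hR.trans (Metric.ball_subset_ball ((Nat.le_ceil R).trans (by exact_mod_cast hn)))
  have hun : IsTestFunction (U n) u := ⟨hu.smooth, hu.compact, Set.subset_inter hu.supp hball⟩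
  -- Both integrals agree because u vanishes off Ω ∩ B_n.
  refine le_trans (le_of_eq ?_) ((hw n).lintegral_div_le hN hs0 hs1 hq hq2 hun)
  have hUm : MeasurableSet (U n) := hΩ.measurableSet.inter measurableSet_ball
  rw [← lintegral_indicator hΩ.measurableSet, ← lintegral_indicator hUm]
  refine lintegral_congr fun x => ?_
  by_cases hx : x ∈ U n
  · rw [Set.indicator_of_mem hx, Set.indicator_of_mem hx.1]
  · rw [Set.indicator_of_notMem hx]
    simp [hun.eq_zero hx]

end Limit

end FracLaneEmden

end

/-- The quotient is taken in `[0, ∞]`: it is `0` where the density is `∞` (and where `u = 0`),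
and it is `∞` where the density vanishes and `u ≠ 0`. -/
theorem mainTheorem4 {N : ℕ} (hN : 1 ≤ N) {s : ℝ} (hs0 : 0 < s) (hs1 : s < 1)
    {q : ℝ} (hq1 : 1 < q) (hq2 : q < 2)
    {Ω : Set (EuclideanSpace ℝ (Fin N))} (hΩ : IsOpen Ω)
    {u : EuclideanSpace ℝ (Fin N) → ℝ} (hu : FracLaneEmden.IsTestFunction Ω u) :
    ∫⁻ x in Ω, ENNReal.ofReal (u x ^ 2) / FracLaneEmden.laneEmdenDensity s q Ω x ^ (2 - q) ≤
      FracLaneEmden.gagliardo s u := by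
  exact FracLaneEmden.lintegral_div_laneEmdenDensity_le hN hs0 hs1 (one_pos.trans hq1) hq2 hΩ hu
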